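/- Let $K\ge 1$ and let $P\in[0,1]^{K\times K}$ be a fixed preference matrix, i.e. $P(i,j)+P(j,i)=1$ for all $i,j$ (so $P(k,k)=\tfrac12$). Assume that $P$ has a Condorcet winner $k^{\rm cw}\in[K]$, i.e. $P(k^{\rm cw},k)>\tfrac12$ for all $k\ne k^{\rm cw}$, and put $\Delta_k:=P(k^{\rm cw},k)-\tfrac12$ and $\Delta_{\min}:=\min_{k\ne k^{\rm cw}}\Delta_k$ (for $K=1$ the term $1/\Delta_{\min}$ below is read as $0$). Consider the following algorithm. Let $\mathcal S=\{w\in\mathbb R^K: w_k\ge 0,\ \sum_k w_k=1\}$ be the simplex, let $\mathcal I_{\mathcal S}$ be its convex indicator ($0$ on $\mathcal S$, $+\infty$ outside), and let $\Psi_t(w)=-2\sqrt t\,\sum_{k=1}^K(\sqrt{w_k}-w_k/2)$. Start with $\hat L_{+1,0}=\hat L_{-1,0}=0\in\mathbb R^K$. In each round $t=1,2,\dots,T$: 1. for $i\in\{+1,-1\}$ let $p_{i,t}=\nabla(\Psi_t+\mathcal I_{\mathcal S})^*(-\hat L_{i,t-1})$ (gradient of the convex conjugate; it is a probability vector), and draw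 $k_{+1,t}\sim p_{+1,t}$ and $k_{-1,t}\sim p_{-1,t}$ independently given the past; 2. observe the feedback $o_t(k_{+1,t},k_{-1,t})$, which is a Bernoulli variable with parameter $P(k_{+1,t},k_{-1,t})$ if $k_{+1,t}\neq k_{-1,t}$, and equals $\tfrac12$ if $k_{+1,t}=k_{-1,t}$; set $o_t(k_{-1,t},k_{+1,t})=1-o_t(k_{+1,t},k_{-1,t})$; 3. for $i\in\{+1,-1\}$ set $\hat L_{i,t}=\hat L_{i,t-1}+\hat\ell_{i,t}$, where $\hat\ell_{i,t}(k)=o_t(k_{-i,t},k_{i,t})/p_{i,t}(k)$ if $k=k_{i,t}$ and $\hat\ell_{i,t}(k)=0$ otherwise. For $k\in[K]$ let $R_T(k)=\sum_{t=1}^T\tfrac12\big(P(k,k_{+1,t})+P(k,k_{-1,t})-1\big)$, and let $\overline R_T=\max_{k\in[K]}\mathbf E[R_T(k)]$ be the pseudo-regret. Then, for every $T\ge 1$, $$\mathbf E[R_T(k^{\rm cw})]=\frac12\,\mathbf E\Big[\sum_{t=1}^T\sum_{k\neq k^{\rm cw}}\big(p_{+1,t}(k)+p_{-1,t}(k)\big)\Delta_k\Big].$$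 Moreover the self-bounding condition holds with $C=0$: the vector $\Delta$ lies in $[0,1]^K$, its unique zero coordinate is $k^{\rm cw}$, and $$\overline R_T\ \ge\ \frac12\,\mathbf E\Big[\sum_{t=1}^T\sum_{k\neq k^{\rm cw}}\big(p_{+1,t}(k)+p_{-1,t}(k)\big)\Delta_k\Big]-C .$$ Finally, $$\overline R_T\ \le\ \sum_{k\neq k^{\rm cw}}\frac{4\log T+12}{\Delta_k}+4\log T+\frac1{\Delta_{\min}}+\frac32\sqrt K+8 .$$ -/

import Mathlib

open Topology

noncomputable section

namespace DuelingBandit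

/-! ## Preference matrices -/

/-- A preference matrix on `K` arms: `P i j` is the probability that arm `i` wins a duel against
arm `j`. In particular `P i i = 1/2`. -/
structure PreferenceMatrix (K : ℕ) where
  prob : Fin K → Fin K → ℝ
  nonneg : ∀ i j, 0 ≤ prob i j
  add_swap : ∀ i j, prob i j + prob j i = 1

/-- `c` is a Condorcet winner of `P`: it beats every other arm with probability more than `1/2`. -/
def IsCondorcetWinner {K : ℕ} (P : PreferenceMatrix K) (c : Fin K) : Prop :=
  ∀ k, k ≠ c → 1 / 2 < P.prob c k

/-- The gap `Δ_k = P(c, k) - 1/2`. -/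
def gap {K : ℕ} (P : PreferenceMatrix K) (c k : Fin K) : ℝ := P.prob c k - 1 / 2

/-- `Δ_min`, the least gap over the arms different from `c`. -/
def gapMin {K : ℕ} (P : PreferenceMatrix K) (c : Fin K) : ℝ := ⨅ k : {k : Fin K // k ≠ c}, gap P c k

/-! ## The regularizer and the weights it induces -/

/-- Vectors indexed by the arms, with the Euclidean inner product. -/
abbrev Vec (K : ℕ) : Type := EuclideanSpace ℝ (Fin K)

/-- The probability simplex. -/
def simplex (K : ℕ) : Set (Vec K) := {w | w.ofLp ∈ stdSimplex ℝ (Fin K)}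

/-- The convex conjugate `(Ψ + I)^*`, where `I` is the convex indicator of the simplex (zero on the
simplex and infinite outside, so that the supremum runs over the simplex). -/
def conjSimplex {K : ℕ} (Ψ : Vec K → ℝ) (θ : Vec K) : ℝ :=
  sSup ((fun w => inner ℝ θ w - Ψ w) '' simplex K)

/-- The Tsallis regularizer of order `1/2` with learning rate `η_t = 2 / √t`, that is
`Ψ_t(w) = - (4 / η_t) ∑_k (√w_k - w_k / 2) = - 2 √t ∑_k (√w_k - w_k / 2)`. -/
def tsallis {K : ℕ} (t : ℕ) (w : Vec K) : ℝ :=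
  -(2 * √(t : ℝ)) * ∑ k, (√(w k) - w k / 2)

/-- The weights `∇(Ψ_t + I)^*(-L)` for the cumulative estimated losses `L`. -/
def weights {K : ℕ} (t : ℕ) (L : Vec K) : Vec K := gradient (conjSimplex (tsallis t)) (-L)

/-! These weights are a probability vector: the gradient exists and it is the maximizer. -/

theorem isCompact_simplex (K : ℕ) : IsCompact (simplex K) := by
  have h : simplex K = (WithLp.toLp 2) '' stdSimplex ℝ (Fin K) := by
    ext w
    constructor
    · intro hw
      exact ⟨w.ofLp, hw, rfl⟩
    · rintro ⟨v, hv, rfl⟩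
      exact hv
  rw [h]
  exact (isCompact_stdSimplex ℝ (Fin K)).image (PiLp.continuous_toLp 2 _)

theorem simplex_nonempty (K : ℕ) [NeZero K] : (simplex K).Nonempty :=
  ⟨WithLp.toLp 2 (Pi.single 0 1), single_mem_stdSimplex ℝ (0 : Fin K)⟩

theorem simplex_mid {K : ℕ} {w v : Vec K} (hw : w ∈ simplex K) (hv : v ∈ simplex K) :
    (2⁻¹ : ℝ) • (w + v) ∈ simplex K := by
  have := convex_stdSimplex ℝ (Fin K) hw hv (a := 2⁻¹) (b := 2⁻¹) (by norm_num) (by norm_num)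
    (by norm_num)
  simpa [simplex, smul_add] using this

theorem continuous_objective {K : ℕ} (t : ℕ) (θ : Vec K) :
    Continuous fun w : Vec K => inner ℝ θ w - tsallis t w := by
  unfold tsallis
  fun_prop

theorem sqrt_mid {x y : ℝ} (hx : 0 ≤ x) (hy : 0 ≤ y) (hx1 : x ≤ 1) (hy1 : y ≤ 1) :
    (√x + √y) / 2 + (x - y) ^ 2 / 32 ≤ √((x + y) / 2) := by
  have ha := Real.sqrt_nonneg x
  have hb := Real.sqrt_nonneg y
  have ha1 : √x ≤ 1 := Real.sqrt_le_one.mpr hx1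
  have hb1 : √y ≤ 1 := Real.sqrt_le_one.mpr hy1
  have hxa := Real.sq_sqrt hx
  have hyb := Real.sq_sqrt hy
  generalize √x = a at *
  generalize √y = b at *
  subst hxa hyb
  apply Real.le_sqrt_of_sq_le
  have h1 : (a ^ 2 - b ^ 2) ^ 2 ≤ 4 * (a - b) ^ 2 := by
    have : (a + b) ^ 2 ≤ 4 := by nlinarith
    nlinarith [mul_le_mul_of_nonneg_left this (sq_nonneg (a - b))]
  have h2 : (a - b) ^ 2 ≤ 1 := by nlinarith
  have h3 : (a ^ 2 - b ^ 2) ^ 2 / 32 ≤ (a - b) ^ 2 / 8 := by linarith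
  have h4 : 0 ≤ (a ^ 2 - b ^ 2) ^ 2 / 32 := by positivity
  calc ((a + b) / 2 + (a ^ 2 - b ^ 2) ^ 2 / 32) ^ 2
      ≤ ((a + b) / 2 + (a - b) ^ 2 / 8) ^ 2 := by gcongr
    _ ≤ (a ^ 2 + b ^ 2) / 2 := by
      have h5 : (a - b) ^ 2 ≤ 2 - a - b := by
        nlinarith [mul_nonneg (sub_nonneg.2 ha1) (sub_nonneg.2 hb1)]
      have h6 : (a + b) / 2 + (a - b) ^ 2 / 16 ≤ 1 := by nlinarith [sq_nonneg (a - b)]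
      nlinarith [mul_le_mul_of_nonneg_left h6 (sq_nonneg (a - b))]

theorem objective_mid {K : ℕ} (t : ℕ) (θ : Vec K) {w v : Vec K}
    (hw : w ∈ simplex K) (hv : v ∈ simplex K) :
    ((inner ℝ θ w - tsallis t w) + (inner ℝ θ v - tsallis t v)) / 2
        + √(t : ℝ) / 16 * ‖w - v‖ ^ 2
      ≤ inner ℝ θ ((2⁻¹ : ℝ) • (w + v)) - tsallis t ((2⁻¹ : ℝ) • (w + v)) := by
  have h1 : ∀ {u : Vec K}, u ∈ simplex K → ∀ k, u k ≤ 1 := fun hu k => by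
    rw [← hu.2]
    exact Finset.single_le_sum (fun j _ => hu.1 j) (Finset.mem_univ k)
  have key : ∑ k, ((√(w k) - w k / 2) + (√(v k) - v k / 2)) / 2 + ∑ k, (w k - v k) ^ 2 / 32
      ≤ ∑ k, (√(((2⁻¹ : ℝ) • (w + v)) k) - ((2⁻¹ : ℝ) • (w + v)) k / 2) := by
    rw [← Finset.sum_add_distrib]
    refine Finset.sum_le_sum fun k _ => ?_
    have := sqrt_mid (hw.1 k) (hv.1 k) (h1 hw k) (h1 hv k)
    have e : ((2⁻¹ : ℝ) • (w + v)) k = (w k + v k) / 2 := by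
      simp only [PiLp.smul_apply, PiLp.add_apply, smul_eq_mul]
      ring
    rw [e]
    change _ + (w k - v k) ^ 2 / 32 ≤ √((w k + v k) / 2) at this
    change (√(w k) + √(v k)) / 2 + _ ≤ _ at this
    linarith
  rw [← Finset.sum_div, ← Finset.sum_div, Finset.sum_add_distrib] at key
  have hn : ‖w - v‖ ^ 2 = ∑ k, (w k - v k) ^ 2 := by
    simp [EuclideanSpace.norm_sq_eq]
  rw [hn, inner_smul_right, inner_add_right]
  unfold tsallis
  nlinarith [mul_le_mul_of_nonneg_left key (Real.sqrt_nonneg (t : ℝ))]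

/-- The conjugate is differentiable, and its gradient is the maximizer over the simplex. -/
theorem exists_hasGradientAt (K : ℕ) [NeZero K] {t : ℕ} (ht : 0 < t) (θ : Vec K) :
    ∃ w ∈ simplex K, IsMaxOn (fun w => inner ℝ θ w - tsallis t w) (simplex K) w ∧
      HasGradientAt (conjSimplex (tsallis t)) w θ := by
  have hex : ∀ θ : Vec K, ∃ w ∈ simplex K,
      IsMaxOn (fun w => inner ℝ θ w - tsallis t w) (simplex K) w := fun θ =>
    (isCompact_simplex K).exists_isMaxOn (simplex_nonempty K) (continuous_objective t θ).continuousOn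
  choose W hW hmax using hex
  have hval : ∀ θ, conjSimplex (tsallis t) θ = inner ℝ θ (W θ) - tsallis t (W θ) := fun θ =>
    IsGreatest.csSup_eq ⟨⟨W θ, hW θ, rfl⟩, by
      rintro _ ⟨v, hv, rfl⟩
      exact hmax θ hv⟩
  have hs : (0 : ℝ) < √(t : ℝ) := Real.sqrt_pos.mpr (by exact_mod_cast ht)
  have hgap : ∀ θ, ∀ v ∈ simplex K, (inner ℝ θ v - tsallis t v) + √(t : ℝ) / 8 * ‖W θ - v‖ ^ 2
      ≤ inner ℝ θ (W θ) - tsallis t (W θ) := fun θ v hv => by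
    have h1 := objective_mid t θ (hW θ) hv
    have h2 : inner ℝ θ ((2⁻¹ : ℝ) • (W θ + v)) - tsallis t ((2⁻¹ : ℝ) • (W θ + v))
        ≤ inner ℝ θ (W θ) - tsallis t (W θ) := hmax θ (simplex_mid (hW θ) hv)
    linarith
  refine ⟨W θ, hW θ, hmax θ, ?_⟩
  rw [hasGradientAt_iff_isLittleO_nhds_zero]
  have hO : (fun h : Vec K => conjSimplex (tsallis t) (θ + h) - conjSimplex (tsallis t) θ
      - inner ℝ (W θ) h) =O[𝓝 0] fun h => ‖h‖ ^ 2 := by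
    refine Asymptotics.IsBigO.of_bound (4 / √(t : ℝ)) (Filter.Eventually.of_forall fun h => ?_)
    have a1 := hgap θ _ (hW (θ + h))
    have a2 := hgap (θ + h) _ (hW θ)
    rw [hval, hval]
    have sw : ‖W (θ + h) - W θ‖ = ‖W θ - W (θ + h)‖ := norm_sub_rev _ _
    rw [sw] at a2
    have cs : inner ℝ h (W (θ + h) - W θ) ≤ ‖h‖ * ‖W θ - W (θ + h)‖ := by
      rw [← sw]
      exact real_inner_le_norm _ _
    rw [inner_sub_right] at cs
    rw [real_inner_comm h (W θ)]
    simp only [inner_add_left] at a1 a2 ⊢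
    set d := ‖W θ - W (θ + h)‖
    have hd : 0 ≤ d := norm_nonneg _
    have hh : 0 ≤ ‖h‖ := norm_nonneg _
    have q : 0 ≤ √(t : ℝ) / 8 * d ^ 2 := by positivity
    have q2 : √(t : ℝ) / 4 * d ^ 2 ≤ ‖h‖ * d := by linarith
    have q3 : √(t : ℝ) * d ≤ 4 * ‖h‖ := by
      rcases hd.eq_or_lt with h0 | h0
      · rw [← h0]
        simp
      · by_contra hc
        push Not at hc
        nlinarith
    have q4 : ‖h‖ * d ≤ 4 / √(t : ℝ) * ‖h‖ ^ 2 := by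
      rw [div_mul_eq_mul_div, le_div_iff₀ hs]
      nlinarith
    rw [Real.norm_of_nonneg (by linarith), Real.norm_of_nonneg (by positivity)]
    linarith
  exact hO.trans_isLittleO (Asymptotics.isLittleO_norm_pow_id one_lt_two)

theorem weights_mem_simplex {K : ℕ} [NeZero K] {t : ℕ} (ht : 0 < t) (L : Vec K) :
    weights t L ∈ simplex K := by
  obtain ⟨w, hw, -, hg⟩ := exists_hasGradientAt K ht (-L)
  rw [weights, hg.gradient]
  exact hw

/-! ## The algorithm -/

/-- The two players that choose the two arms of a duel. -/
inductive Player
  | plus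
  | minus

/-- The record of one round: the arms `k₊`, `k₋` of the duel and the Boolean outcome of a coin that
tells whether `k₊` wins. The coin is ignored when `k₊ = k₋`, see `outcome`. -/
abbrev Round (K : ℕ) : Type := (Fin K × Fin K) × Bool

/-- The arm chosen by a player. -/
def arm {K : ℕ} : Player → Round K → Fin K
  | .plus, r => r.1.1
  | .minus, r => r.1.2

/-- The preference feedback `o_t(k₊, k₋)`, with the convention `o_t(k, k) = 1/2`. -/
def outcome {K : ℕ} (r : Round K) : ℝ :=
  if r.1.1 = r.1.2 then 1 / 2 else if r.2 then 1 else 0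

/-- The loss `ℓ_{i,t}(k_{i,t}) = o_t(k_{-i,t}, k_{i,t})` of player `i`,
where `o_t(k₋, k₊) = 1 - o_t(k₊, k₋)`. -/
def loss {K : ℕ} : Player → Round K → ℝ
  | .plus, r => 1 - outcome r
  | .minus, r => outcome r

/-- The importance weighted loss estimate of player `i`, when its arm was drawn from `p`. -/
def lossEst {K : ℕ} (i : Player) (p : Vec K) (r : Round K) : Vec K :=
  WithLp.toLp 2 fun k => if k = arm i r then loss i r / p k else 0

/-- The cumulative loss estimates of player `i` after `t` rounds. -/
def cumEst {K : ℕ} (i : Player) : (t : ℕ) → (Fin t → Round K) → Vec K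
  | 0, _ => 0
  | t + 1, h =>
    cumEst i t (Fin.init h)
      + lossEst i (weights (t + 1) (cumEst i t (Fin.init h))) (h (Fin.last t))

/-- The weights that player `i` uses in round `t + 1` after the history `h` of the first `t`
rounds. -/
def play {K : ℕ} (i : Player) (t : ℕ) (h : Fin t → Round K) : Vec K :=
  weights (t + 1) (cumEst i t h)

/-- A probability vector as a law on a finite type. -/
def lawOf {α : Type} [Fintype α] (q : α → ℝ) (h0 : ∀ a, 0 ≤ q a) (h1 : ∑ a, q a = 1) : PMF α :=
  PMF.ofFintype (fun a => ENNReal.ofReal (q a)) (by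
    rw [← ENNReal.ofReal_sum_of_nonneg fun a _ => h0 a, h1, ENNReal.ofReal_one])

/-- The law of the arm drawn by player `i` in round `t + 1`, given the history. -/
def armLaw {K : ℕ} [NeZero K] (i : Player) (t : ℕ) (h : Fin t → Round K) : PMF (Fin K) :=
  lawOf (fun k => play i t h k) (weights_mem_simplex t.succ_pos _).1
    (weights_mem_simplex t.succ_pos _).2

/-- The Bernoulli law with parameter `P(a, b)` of the event that `a` beats `b`. -/
def duelLaw {K : ℕ} (P : PreferenceMatrix K) (a b : Fin K) : PMF Bool :=
  lawOf (fun x => if x then P.prob a b else P.prob b a)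
    (by
      intro x
      cases x
      · simpa using P.nonneg b a
      · simpa using P.nonneg a b)
    (by simpa using P.add_swap a b)

/-- The law of the first `t` rounds of the algorithm against the fixed preference matrix `P`: in
every round both players draw their arms independently given the past, and then the two arms
duel. -/
def run {K : ℕ} [NeZero K] (P : PreferenceMatrix K) : (t : ℕ) → PMF (Fin t → Round K)
  | 0 => PMF.pure Fin.elim0
  | t + 1 =>
    (run P t).bind fun h =>
      (armLaw .plus t h).bind fun a =>
        (armLaw .minus t h).bind fun b =>
          (duelLaw P a b).map fun x => (Fin.snoc h ((a, b), x) : Fin (t + 1) → Round K)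

/-! ## Regret -/

/-- The expectation of `f` over the first `T` rounds of the algorithm. -/
def expect {K : ℕ} [NeZero K] (P : PreferenceMatrix K) (T : ℕ) (f : (Fin T → Round K) → ℝ) : ℝ :=
  ∑ h, (run P T h).toReal * f h

/-- The regret `R_T(k) = ∑_{t ≤ T} (P(k, k_{+1,t}) + P(k, k_{-1,t}) - 1) / 2`. -/
def regret {K : ℕ} (P : PreferenceMatrix K) {T : ℕ} (k : Fin K) (h : Fin T → Round K) : ℝ :=
  ∑ t, 1 / 2 * (P.prob k (arm .plus (h t)) + P.prob k (arm .minus (h t)) - 1)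

/-- The pseudo-regret `max_k E[R_T(k)]`. -/
def pseudoRegret {K : ℕ} [NeZero K] (P : PreferenceMatrix K) (T : ℕ) : ℝ :=
  Finset.univ.sup' Finset.univ_nonempty fun k => expect P T (regret P k)

/-- The probability `p_{i,t}(k)` with which player `i` plays arm `k` in round `t`, along the
history `h`. Rounds are counted from zero here. -/
def playProb {K T : ℕ} (i : Player) (h : Fin T → Round K) (t : Fin T) (k : Fin K) : ℝ :=
  play i t (Fin.take t t.is_lt.le h) k

/-- The quantity `1/2 E[∑_{t ≤ T} ∑_{k ≠ c} (p_{+1,t}(k) + p_{-1,t}(k)) D_k]`. -/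
def weightedGapSum {K : ℕ} [NeZero K] (P : PreferenceMatrix K) (T : ℕ) (D : Fin K → ℝ)
    (c : Fin K) : ℝ :=
  1 / 2 * expect P T fun h =>
    ∑ t, ∑ k with k ≠ c, (playProb .plus h t k + playProb .minus h t k) * D k

/-- The self-bounding condition with gap vector `D`, whose unique zero coordinate is `c`, and
constant `C`. -/
def SelfBounding {K : ℕ} [NeZero K] (P : PreferenceMatrix K) (T : ℕ) (D : Fin K → ℝ) (c : Fin K)
    (C : ℝ) : Prop :=
  (∀ k, D k ∈ Set.Icc (0 : ℝ) 1) ∧ (∀ k, D k = 0 ↔ k = c) ∧ 0 ≤ C ∧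
    weightedGapSum P T D c - C ≤ pseudoRegret P T

end DuelingBandit

end

open DuelingBandit

/-!
Each player runs follow the regularized leader with the Tsallis regularizer of order `1/2` on
importance weighted losses, and the regret of the duels is the average of the two players' regrets:
the estimated losses have the right conditional mean (`roundMean_loss_sub_lossEst`), and the two
losses of a duel add up to one.

*Regret of one player.* The potential `∑ loss + Φ_t(-L_t)`, with `Φ_t` the conjugate of the
regularizer on the simplex, grows in every round by a penalty term, from the change of the
regularizer (`conjSimplex_succ_le`), and a stability term, from the change of the losses
(`stability_le`). The latter rests on the optimality of the weights with the Bregman divergence as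
remainder (`objective_add_bregman_le`), which needs that the weights are interior (`weights_pos`).
The drawn arm decides how the stability is estimated: if it is the Condorcet winner `c`, then the
observed loss is first subtracted from all coordinates, which does not change anything on the
simplex. Together with the part `1 - √w_c` of the penalty this yields, up to terms whose sum over
the arms and rounds is small, the bound `∑_{j ≠ c} (2 √w_j + w_j / 4) / √t`
(`two_mul_roundBound_le`), in which the arm `c` does not occur.

*Self-bounding.* The regret against `c` equals the expected sum of the weights times the gaps
(`expect_regret_eq`), and the pseudo-regret is at least that. Hence the pseudo-regret `R` satisfies
`R = 2 R - R ≤ E ∑ (2 (round bound) - (weights times gaps))`, averaged over the players, and here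
each arm contributes in round `t` at most `max_w (4 √(w / t) - Δ w) = 4 / (Δ t)` plus an excess
caused by the linear term. The first parts sum to `4 (1 + log T) / Δ` and the excesses to at most
`5 / Δ` (`sum_arm_excess_le`), so that the bound holds along every trajectory
(`sum_roundBound_le`).
-/

namespace DuelingBandit

/-! ### The weights as the solution of a convex program -/

theorem simplex_apply_le_one {K : ℕ} {w : Vec K} (hw : w ∈ simplex K) (k : Fin K) : w k ≤ 1 := by
  rw [← hw.2]
  exact Finset.single_le_sum (fun j _ => hw.1 j) (Finset.mem_univ k)

theorem inner_neg_eq {K : ℕ} (L w : Vec K) : inner ℝ (-L) w = -∑ k, L k * w k := by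
  simp [PiLp.inner_apply, mul_comm]

theorem tsallis_eq {K : ℕ} (t : ℕ) {w : Vec K} (hw : w ∈ simplex K) :
    tsallis t w = √(t : ℝ) * (1 - 2 * ∑ k, √(w k)) := by
  have h : ∑ k, w k = 1 := hw.2
  rw [tsallis, Finset.sum_sub_distrib, ← Finset.sum_div, h]
  ring

theorem le_conjSimplex {K : ℕ} (t : ℕ) (L : Vec K) {w : Vec K} (hw : w ∈ simplex K) :
    -∑ k, L k * w k - tsallis t w ≤ conjSimplex (tsallis t) (-L) := by
  rw [← inner_neg_eq]
  exact le_csSup ((isCompact_simplex K).image (continuous_objective t (-L))).bddAbove ⟨w, hw, rfl⟩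

theorem conjSimplex_le {K : ℕ} [NeZero K] (t : ℕ) (L : Vec K) {C : ℝ}
    (h : ∀ w ∈ simplex K, -∑ k, L k * w k - tsallis t w ≤ C) :
    conjSimplex (tsallis t) (-L) ≤ C := by
  refine csSup_le ((simplex_nonempty K).image _) ?_
  rintro _ ⟨w, hw, rfl⟩
  have := h w hw
  rwa [← inner_neg_eq] at this

theorem weights_isMaxOn {K : ℕ} [NeZero K] {t : ℕ} (ht : 0 < t) (L : Vec K) :
    IsMaxOn (fun w => -∑ k, L k * w k - tsallis t w) (simplex K) (weights t L) := by
  obtain ⟨w, -, hm, hg⟩ := exists_hasGradientAt K ht (-L)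
  rw [weights, hg.gradient]
  simpa only [inner_neg_eq] using hm

theorem conjSimplex_eq {K : ℕ} [NeZero K] {t : ℕ} (ht : 0 < t) (L : Vec K) :
    conjSimplex (tsallis t) (-L) = -∑ k, L k * weights t L k - tsallis t (weights t L) :=
  le_antisymm (conjSimplex_le t L fun _ hw => weights_isMaxOn ht L hw)
    (le_conjSimplex t L (weights_mem_simplex ht L))

/-- Optimality of the weights, compared with the points of a segment of the simplex. -/
theorem weights_segment {K : ℕ} [NeZero K] {t : ℕ} (ht : 0 < t) (L : Vec K) {v : Vec K}
    (hv : v ∈ simplex K) {ε : ℝ} (h0 : 0 ≤ ε) (h1 : ε ≤ 1) :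
    2 * √(t : ℝ) * ∑ k, (√(weights t L k + ε * (v k - weights t L k)) - √(weights t L k))
      ≤ ε * ∑ k, L k * (v k - weights t L k) := by
  set w := weights t L with hwdef
  have hw : w ∈ simplex K := weights_mem_simplex ht L
  have hu : w + ε • (v - w) ∈ simplex K := by
    have := convex_stdSimplex ℝ (Fin K) hw hv (a := 1 - ε) (b := ε) (by linarith) h0 (by ring)
    have e : w + ε • (v - w) = (1 - ε) • w + ε • v := by module
    rw [e]
    exact this
  have hm : -∑ k, L k * (w + ε • (v - w)) k - tsallis t (w + ε • (v - w))
      ≤ -∑ k, L k * w k - tsallis t w := weights_isMaxOn ht L hu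
  rw [tsallis_eq t hu, tsallis_eq t hw] at hm
  have e1 : ∑ k, L k * (w + ε • (v - w)) k
      = ∑ k, L k * w k + ε * ∑ k, L k * (v k - w k) := by
    rw [Finset.mul_sum, ← Finset.sum_add_distrib]
    refine Finset.sum_congr rfl fun k _ => ?_
    simp only [PiLp.add_apply, PiLp.smul_apply, PiLp.sub_apply, smul_eq_mul]
    ring
  rw [e1] at hm
  simp only [PiLp.add_apply, PiLp.smul_apply, PiLp.sub_apply, smul_eq_mul] at hm
  rw [Finset.sum_sub_distrib]
  linarith

/-- The weights are interior: moving mass `ε` to an arm without mass would gain `√ε` in the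
regularizer and lose only a multiple of `ε`. -/
theorem weights_pos {K : ℕ} [NeZero K] {t : ℕ} (ht : 0 < t) (L : Vec K) (j : Fin K) :
    0 < weights t L j := by
  have hw : weights t L ∈ simplex K := weights_mem_simplex ht L
  refine lt_of_le_of_ne (hw.1 j) fun hj => ?_
  set w := weights t L with hwdef
  change 0 = w j at hj
  have hv : (WithLp.toLp 2 (Pi.single j 1) : Vec K) ∈ simplex K := single_mem_stdSimplex ℝ j
  set v : Vec K := WithLp.toLp 2 (Pi.single j 1) with hvdef
  have hs : (0 : ℝ) < √(t : ℝ) := Real.sqrt_pos.mpr (by exact_mod_cast ht)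
  set A := ∑ k, L k * (v k - w k) with hA
  set B := ∑ k, √(w k) with hB
  have key : ∀ ε : ℝ, 0 ≤ ε → ε ≤ 1 → 2 * √(t : ℝ) * (√ε - ε * B) ≤ ε * A := by
    intro ε h0 h1
    refine le_trans ?_ (weights_segment ht L hv h0 h1)
    rw [← hwdef]
    gcongr
    have hterm : ∀ k, (if k = j then √ε else 0) - ε * √(w k)
        ≤ √(w k + ε * (v k - w k)) - √(w k) := by
      intro k
      by_cases hk : k = j
      · subst hk
        simp [← hj, hvdef]
      · have e : w k + ε * (v k - w k) = (1 - ε) * w k := by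
          simp [hvdef, hk]
          ring
        have h2 : (1 - ε) * √(w k) ≤ √((1 - ε) * w k) := by
          rw [Real.sqrt_mul (by linarith)]
          gcongr
          exact Real.le_sqrt_of_sq_le (by nlinarith)
        rw [e, if_neg hk]
        linarith
    calc √ε - ε * B = ∑ k, ((if k = j then √ε else 0) - ε * √(w k)) := by
          rw [Finset.sum_sub_distrib, ← Finset.mul_sum]
          simp [hB]
      _ ≤ _ := Finset.sum_le_sum fun k _ => hterm k
  -- Dividing by `√ε` and letting `ε` tend to zero refutes the inequality.
  set D := |A| + 2 * √(t : ℝ) * |B| with hD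
  have hD0 : 0 ≤ D := by positivity
  set δ := min 1 (√(t : ℝ) / (D + 1)) with hδ
  have hδ0 : 0 < δ := lt_min one_pos (by positivity)
  have hδ1 : δ ≤ 1 := min_le_left _ _
  have hδ2 : δ * (D + 1) ≤ √(t : ℝ) := by
    rw [← le_div_iff₀ (by positivity)]
    exact min_le_right _ _
  have h3 := key (δ ^ 2) (by positivity) (pow_le_one₀ hδ0.le hδ1)
  rw [Real.sqrt_sq hδ0.le] at h3
  have h4 : A ≤ |A| := le_abs_self A
  have h5 : B ≤ |B| := le_abs_self B
  have h6 : 2 * √(t : ℝ) * δ ≤ δ ^ 2 * D := by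
    have : 2 * √(t : ℝ) * δ ≤ δ ^ 2 * (A + 2 * √(t : ℝ) * B) := by linarith
    refine this.trans ?_
    rw [hD]
    gcongr
  nlinarith [mul_le_mul_of_nonneg_left hδ2 hδ0.le, mul_pos hδ0 hs, mul_pos hδ0 hδ0]

/-- The first order optimality condition of the weights. -/
theorem weights_variational {K : ℕ} [NeZero K] {t : ℕ} (ht : 0 < t) (L : Vec K) {v : Vec K}
    (hv : v ∈ simplex K) :
    ∑ k, L k * (weights t L k - v k)
      ≤ √(t : ℝ) * ∑ k, (weights t L k - v k) / √(weights t L k) := by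
  have hw : weights t L ∈ simplex K := weights_mem_simplex ht L
  have hpos := weights_pos ht L
  have hseg := fun ε h0 h1 => weights_segment ht L hv (ε := ε) h0 h1
  set w := weights t L with hwdef
  have hcont : Continuous fun ε : ℝ =>
      2 * √(t : ℝ) * ∑ k, (v k - w k) / (√(w k + ε * (v k - w k)) + √(w k)) := by
    refine continuous_const.mul (continuous_finsetSum _ fun k _ => ?_)
    refine Continuous.div (by fun_prop) (by fun_prop) fun ε => ?_
    have := Real.sqrt_pos.mpr (hpos k)
    positivity
  have hle : ∀ᶠ ε in 𝓝[>] (0 : ℝ),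
      2 * √(t : ℝ) * ∑ k, (v k - w k) / (√(w k + ε * (v k - w k)) + √(w k))
        ≤ ∑ k, L k * (v k - w k) := by
    filter_upwards [Ioc_mem_nhdsGT (zero_lt_one : (0 : ℝ) < 1)] with ε hε
    have h := hseg ε hε.1.le hε.2
    refine le_of_mul_le_mul_left (le_trans (le_of_eq ?_) h) hε.1
    rw [mul_left_comm, Finset.mul_sum]
    congr 1
    refine Finset.sum_congr rfl fun k _ => ?_
    have h1 := Real.sqrt_pos.mpr (hpos k)
    have h2 : 0 ≤ w k + ε * (v k - w k) := by
      nlinarith [mul_nonneg (sub_nonneg.2 hε.2) (hw.1 k), mul_nonneg hε.1.le (hv.1 k)]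
    have h3 := Real.sq_sqrt h2
    have h4 := Real.sq_sqrt (hw.1 k)
    have h5 := Real.sqrt_nonneg (w k + ε * (v k - w k))
    have h6 : √(w k + ε * (v k - w k)) + √(w k) ≠ 0 := by positivity
    rw [← mul_div_assoc, div_eq_iff h6]
    linarith
  have hlim := le_of_tendsto ((hcont.tendsto 0).mono_left nhdsWithin_le_nhds) hle
  simp only [zero_mul, add_zero] at hlim
  have e1 : ∑ k, L k * (v k - w k) = -∑ k, L k * (w k - v k) := by
    rw [← Finset.sum_neg_distrib]
    exact Finset.sum_congr rfl fun k _ => by ring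
  have e2 : 2 * √(t : ℝ) * ∑ k, (v k - w k) / (√(w k) + √(w k))
      = -(√(t : ℝ) * ∑ k, (w k - v k) / √(w k)) := by
    rw [Finset.mul_sum, Finset.mul_sum, ← Finset.sum_neg_distrib]
    refine Finset.sum_congr rfl fun k _ => ?_
    have h1 := Real.sqrt_pos.mpr (hpos k)
    field_simp
    ring
  rw [e1, e2] at hlim
  linarith

/-- Strong optimality of the weights: a point `v` loses at least the Bregman divergence
`√t ∑_k (√v_k - √w_k)² / √w_k` of the regularizer. -/
theorem objective_add_bregman_le {K : ℕ} [NeZero K] {t : ℕ} (ht : 0 < t) (L : Vec K) {v : Vec K}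
    (hv : v ∈ simplex K) :
    -∑ k, L k * v k - tsallis t v
        + ∑ k, √(t : ℝ) * (√(v k) - √(weights t L k)) ^ 2 / √(weights t L k)
      ≤ conjSimplex (tsallis t) (-L) := by
  have hw : weights t L ∈ simplex K := weights_mem_simplex ht L
  have hpos := weights_pos ht L
  have h := weights_variational ht L hv
  rw [conjSimplex_eq ht, tsallis_eq t hv, tsallis_eq t hw]
  set w := weights t L with hwdef
  have e1 : ∑ k, L k * (w k - v k) = ∑ k, L k * w k - ∑ k, L k * v k := by
    rw [← Finset.sum_sub_distrib]
    exact Finset.sum_congr rfl fun k _ => by ring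
  have e2 : ∑ k, √(t : ℝ) * (√(v k) - √(w k)) ^ 2 / √(w k)
      = 2 * √(t : ℝ) * (∑ k, √(w k) - ∑ k, √(v k))
        - √(t : ℝ) * ∑ k, (w k - v k) / √(w k) := by
    rw [← Finset.sum_sub_distrib, Finset.mul_sum, Finset.mul_sum, ← Finset.sum_sub_distrib]
    refine Finset.sum_congr rfl fun k _ => ?_
    have h1 := Real.sqrt_pos.mpr (hpos k)
    have h3 := Real.sq_sqrt (hv.1 k)
    have h4 := Real.sq_sqrt (hw.1 k)
    change √(v k) ^ 2 = v k at h3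
    change √(w k) ^ 2 = w k at h4
    generalize √(v k) = b at *
    generalize √(w k) = a at *
    rw [← h3, ← h4]
    field_simp
    ring
  rw [e1] at h
  rw [e2]
  linarith

/-! ### Stability of one round -/

/-- A bound on the stability term of round `t` at the weights `w` when arm `k` is drawn. The loss
estimate is used as it is if `k ≠ c`, and shifted by the observed loss in all coordinates if
`k = c`, which makes the bound small when `w` is close to the vertex `c`. -/
noncomputable def stabBound {K : ℕ} (c : Fin K) (t : ℕ) (w : Vec K) (k : Fin K) : ℝ :=
  if k = c then
    √(w c) ^ 3 * (1 / w c - 1) ^ 2 / √(t : ℝ)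
      + ∑ j with j ≠ c, √(w j) ^ 3 / (√(t : ℝ) - √(w j))
  else 1 / (√(w k) * √(t : ℝ))

/-- The one-dimensional stability estimate for a loss `x ≥ 0`. -/
theorem stab_nonneg_loss {s a b x : ℝ} (hs : 0 < s) (ha : 0 < a) (hx : 0 ≤ x) :
    x * (a ^ 2 - b ^ 2) ≤ a ^ 3 * x ^ 2 / s + s * (b - a) ^ 2 / a := by
  rw [div_add_div _ _ hs.ne' ha.ne', le_div_iff₀ (by positivity)]
  have : 0 ≤ (a ^ 2 * x - s * (a - b)) ^ 2 + x * (a - b) ^ 2 * (s * a) := by positivity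
  nlinarith

/-- The one-dimensional stability estimate for a negative loss `-x`, which has to be smaller than
the curvature of the regularizer. -/
theorem stab_neg_loss {s a b x : ℝ} (ha : 0 < a) (hx : a * x < s) :
    -x * (a ^ 2 - b ^ 2) ≤ a ^ 3 * x ^ 2 / (s - a * x) + s * (b - a) ^ 2 / a := by
  have h : 0 < s - a * x := by linarith
  rw [div_add_div _ _ h.ne' ha.ne', le_div_iff₀ (by positivity)]
  have : 0 ≤ (a ^ 2 * x - (s - a * x) * (b - a)) ^ 2 := by positivity
  nlinarith

theorem simplex_add_le_one {K : ℕ} {w : Vec K} (hw : w ∈ simplex K) {i j : Fin K} (hij : i ≠ j) :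
    w i + w j ≤ 1 := by
  rw [← hw.2, ← Finset.sum_pair hij]
  exact Finset.sum_le_sum_of_subset_of_nonneg (Finset.subset_univ _) fun k _ _ => hw.1 k

/-- The stability term of one round, for the importance weighted estimate of the loss `x` of the
drawn arm `k`. -/
theorem stability_le {K : ℕ} [NeZero K] {t : ℕ} (ht : 0 < t) (L : Vec K) (c k : Fin K) {x : ℝ}
    (hx0 : 0 ≤ x) (hx1 : x ≤ 1) :
    x + conjSimplex (tsallis t)
        (-(L + WithLp.toLp 2 fun j => if j = k then x / weights t L j else 0))
      ≤ conjSimplex (tsallis t) (-L) + stabBound c t (weights t L) k := by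
  have hw : weights t L ∈ simplex K := weights_mem_simplex ht L
  have hpos := weights_pos ht L
  have ht1 : (1 : ℝ) ≤ √(t : ℝ) := Real.one_le_sqrt.mpr (by exact_mod_cast ht)
  suffices h : conjSimplex (tsallis t)
        (-(L + WithLp.toLp 2 fun j => if j = k then x / weights t L j else 0))
      ≤ conjSimplex (tsallis t) (-L) + stabBound c t (weights t L) k - x by linarith
  refine conjSimplex_le t _ fun v hv => ?_
  have hb := objective_add_bregman_le ht L hv
  set w := weights t L with hwdef
  have e : ∑ j, (L + WithLp.toLp 2 fun j => if j = k then x / w j else 0 : Vec K) j * v j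
      = ∑ j, L j * v j + x / w k * v k := by
    simp [add_mul, Finset.sum_add_distrib]
  rw [e]
  suffices h : x - x / w k * v k
      ≤ stabBound c t w k + ∑ j, √(t : ℝ) * (√(v j) - √(w j)) ^ 2 / √(w j) by linarith
  have hsq : ∀ j, √(w j) ^ 2 = w j := fun j => Real.sq_sqrt (hw.1 j)
  have hsv : ∀ j, √(v j) ^ 2 = v j := fun j => Real.sq_sqrt (hv.1 j)
  have hsp : ∀ j, 0 < √(w j) := fun j => Real.sqrt_pos.mpr (hpos j)
  unfold stabBound
  split_ifs with hk
  · subst hk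
    set y := 1 / w k - 1 with hy
    have hy0 : 0 ≤ y := by
      have := one_le_one_div (hpos k) (simplex_apply_le_one hw k)
      linarith
    -- Subtracting `x` from all coordinates is free, since `w` and `v` have the same total mass.
    have hterm : ∀ j, x * ((if j = k then 1 / w k else 0) - 1) * (w j - v j)
        ≤ (if j = k then √(w k) ^ 3 * y ^ 2 / √(t : ℝ)
            else √(w j) ^ 3 / (√(t : ℝ) - √(w j)))
          + √(t : ℝ) * (√(v j) - √(w j)) ^ 2 / √(w j) := by
      intro j
      have hq1 := hsq j
      have hq2 := hsv j
      split_ifs with hj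
      · subst hj
        have h1 := stab_nonneg_loss (b := √(v j)) (zero_lt_one.trans_le ht1) (hsp j)
          (mul_nonneg hx0 hy0)
        rw [hq1, hq2] at h1
        refine h1.trans ?_
        gcongr
        exact mul_le_of_le_one_left hy0 hx1
      · have hlt : √(w j) < 1 := by
          rw [Real.sqrt_lt' one_pos]
          have := simplex_add_le_one hw hj
          have := hpos k
          linarith
        have h0 : √(w j) * x ≤ √(w j) := mul_le_of_le_one_right (hsp j).le hx1
        have h1 := stab_neg_loss (b := √(v j)) (x := x) (s := √(t : ℝ)) (hsp j) (by linarith)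
        rw [hq1, hq2] at h1
        have h2 : √(w j) ^ 3 * x ^ 2 / (√(t : ℝ) - √(w j) * x)
            ≤ √(w j) ^ 3 / (√(t : ℝ) - √(w j)) := by
          have := hsp j
          refine div_le_div₀ (by positivity) ?_ (by linarith) (by linarith)
          exact mul_le_of_le_one_right (by positivity) (pow_le_one₀ hx0 hx1)
        linarith
    have hsum := Finset.sum_le_sum fun j (_ : j ∈ Finset.univ) => hterm j
    have e1 : ∑ j, x * ((if j = k then 1 / w k else 0) - 1) * (w j - v j) = x - x / w k * v k := by
      have h1 : ∑ j, w j = 1 := hw.2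
      have h2 : ∑ j, v j = 1 := hv.2
      have h3 : ∀ j, x * ((if j = k then 1 / w k else 0) - 1) * (w j - v j)
          = (if j = k then x / w k * (w k - v k) else 0) - x * w j + x * v j := by
        intro j
        split_ifs with hj
        · subst hj
          ring
        · ring
      simp only [h3, Finset.sum_add_distrib, Finset.sum_sub_distrib, ← Finset.mul_sum, h1, h2]
      have := (hpos k).ne'
      simp
      field_simp
    have e2 : ∑ j, (if j = k then √(w k) ^ 3 * y ^ 2 / √(t : ℝ)
            else √(w j) ^ 3 / (√(t : ℝ) - √(w j)))
        = √(w k) ^ 3 * y ^ 2 / √(t : ℝ)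
          + ∑ j with j ≠ k, √(w j) ^ 3 / (√(t : ℝ) - √(w j)) := by
      rw [Finset.sum_ite, Finset.filter_eq' _ k]
      simp
    rw [Finset.sum_add_distrib, e1, e2] at hsum
    exact hsum
  · have h1 := stab_nonneg_loss (b := √(v k)) (zero_lt_one.trans_le ht1) (hsp k)
      (div_nonneg hx0 (hpos k).le)
    have h2 : √(t : ℝ) * (√(v k) - √(w k)) ^ 2 / √(w k)
        ≤ ∑ j, √(t : ℝ) * (√(v j) - √(w j)) ^ 2 / √(w j) :=
      Finset.single_le_sum (f := fun j => √(t : ℝ) * (√(v j) - √(w j)) ^ 2 / √(w j))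
        (fun j _ => by positivity) (Finset.mem_univ k)
    have h3 : √(w k) ^ 3 * (x / w k) ^ 2 / √(t : ℝ) ≤ 1 / (√(w k) * √(t : ℝ)) := by
      have e3 : √(w k) ^ 3 * (x / w k) ^ 2 / √(t : ℝ) = x ^ 2 / (√(w k) * √(t : ℝ)) := by
        have h4 := hsp k
        have h5 := hsq k
        generalize √(w k) = a at *
        rw [← h5]
        have : √(t : ℝ) ≠ 0 := by positivity
        field_simp
      rw [e3]
      gcongr
      exact pow_le_one₀ hx0 hx1
    rw [hsq, hsv] at h1
    have h6 : x / w k * (w k - v k) = x - x / w k * v k := by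
      have := (hpos k).ne'
      field_simp
    linarith

/-! ### Summing the bounds over the rounds -/

/-- The contribution of the round with zero-based index `t` to the regret bound, when the weights
are `w`: the growth of the penalty term plus the expected stability bound. -/
noncomputable def roundBound {K : ℕ} (c : Fin K) (t : ℕ) (w : Vec K) : ℝ :=
  2 * (√((t + 1 : ℕ) : ℝ) - √(t : ℝ)) * (∑ k, √(w k) - 1)
    + ∑ k, w k * stabBound c (t + 1) w k

theorem sqrt_increment_ge (t : ℕ) :
    1 / (2 * √((t + 1 : ℕ) : ℝ)) ≤ √((t + 1 : ℕ) : ℝ) - √(t : ℝ) := by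
  have h1 : 0 < √((t + 1 : ℕ) : ℝ) := Real.sqrt_pos.mpr (by positivity)
  have h2 := Real.sq_sqrt (Nat.cast_nonneg (α := ℝ) (t + 1))
  have h3 := Real.sq_sqrt (Nat.cast_nonneg (α := ℝ) t)
  rw [div_le_iff₀ (by positivity)]
  push_cast at *
  nlinarith [sq_nonneg (√((t : ℝ) + 1) - √(t : ℝ))]

theorem sqrt_increment_le {t : ℕ} (ht : 0 < t) :
    √((t + 1 : ℕ) : ℝ) - √(t : ℝ) ≤ 1 / (2 * √(t : ℝ)) := by
  have h1 : 0 < √(t : ℝ) := Real.sqrt_pos.mpr (by exact_mod_cast ht)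
  have h2 := Real.sq_sqrt (Nat.cast_nonneg (α := ℝ) (t + 1))
  have h3 := Real.sq_sqrt (Nat.cast_nonneg (α := ℝ) t)
  rw [le_div_iff₀ (by positivity)]
  push_cast at *
  nlinarith [sq_nonneg (√((t : ℝ) + 1) - √(t : ℝ))]

/-- The part of the stability bound that comes from shifting the losses of an arm `j ≠ c`, with
`a = √w_j`, `p = w_c` and `s = √t`. -/
theorem shifted_term_le {a p s : ℝ} (ha0 : 0 ≤ a) (hp0 : 0 < p) (hp : p + a ^ 2 ≤ 1)
    (hs : 1 ≤ s) : p * (a ^ 3 / (s - a)) ≤ p * a ^ 3 / s + 2 * a ^ 2 / s ^ 2 := by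
  have ha1 : a < 1 := by nlinarith
  have h1 : 0 < s - a := by linarith
  have h2 : p * s ≤ 2 * (s - a) := by
    nlinarith [mul_nonneg (sub_nonneg.2 hs) (by positivity : 0 ≤ 1 + a ^ 2), sq_nonneg (1 - a)]
  have h3 : a ^ 4 ≤ a ^ 2 := pow_le_pow_of_le_one ha0 ha1.le (by norm_num)
  have h0 : 0 < s := by linarith
  have e : p * (a ^ 3 / (s - a)) = p * a ^ 3 / s + p * s * a ^ 4 / (s ^ 2 * (s - a)) := by
    field_simp
    ring
  have h4 : p * s * a ^ 4 ≤ 2 * (s - a) * a ^ 2 :=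
    mul_le_mul h2 h3 (by positivity) (by linarith)
  have h5 : p * s * a ^ 4 / (s ^ 2 * (s - a)) ≤ 2 * a ^ 2 / s ^ 2 := by
    rw [div_le_div_iff₀ (by positivity) (by positivity)]
    linarith [mul_le_mul_of_nonneg_right h4 (sq_nonneg s)]
  linarith

theorem mul_sq_add_sq_mul_le {b q : ℝ} (hb : 0 ≤ b) (hq : 0 ≤ q) (h : b ^ 2 + q ^ 2 = 1) :
    b * q ^ 2 + b ^ 2 * q ≤ 3 / 4 := by
  have h1 : b * q ≤ 1 / 2 := by linarith [sq_nonneg (b - q), sub_sq b q]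
  have h2 : b + q ≤ 3 / 2 := abs_le_of_sq_le_sq' (by linarith [add_sq b q]) (by norm_num) |>.2
  have h3 := mul_le_mul h1 h2 (by positivity) (by norm_num)
  linarith

/-- The round bound in terms of the arms other than `c` only. The term linear in the weights has
the small constant `1 / 2`, because the penalty `1 - √w_c` of the arm `c` compensates most of the
stability. -/
theorem two_mul_roundBound_le {K : ℕ} (c : Fin K) (t : ℕ) {w : Vec K} (hw : w ∈ simplex K)
    (hpos : ∀ k, 0 < w k) :
    2 * roundBound c t w ≤
      ∑ j with j ≠ c, (4 * √(w j) / √((t + 1 : ℕ) : ℝ) + w j / (2 * √((t + 1 : ℕ) : ℝ))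
        + 4 * ((√((t + 1 : ℕ) : ℝ) - √(t : ℝ))
          - (√((t + 1 + 1 : ℕ) : ℝ) - √((t + 1 : ℕ) : ℝ))))
      + 4 / ((t : ℝ) + 1) := by
  set s := √((t + 1 : ℕ) : ℝ) with hsdef
  have hs1 : 1 ≤ s := Real.one_le_sqrt.mpr (by simp)
  have hs2 : s ^ 2 = (t : ℝ) + 1 := by
    rw [hsdef, Real.sq_sqrt (by positivity)]
    push_cast
    ring
  have hd := sqrt_increment_ge t
  rw [← hsdef] at hd
  have hd' : √((t + 1 + 1 : ℕ) : ℝ) - s ≤ 1 / (2 * s) :=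
    sqrt_increment_le t.succ_pos
  set δ := s - √(t : ℝ) with hδ
  set δ' := √((t + 1 + 1 : ℕ) : ℝ) - s with hδ'
  have hsplit : ∀ f : Fin K → ℝ, ∑ k, f k = f c + ∑ j with j ≠ c, f j := fun f => by
    rw [Finset.filter_ne', Finset.add_sum_erase _ _ (Finset.mem_univ c)]
  have hsq : ∀ j, √(w j) ^ 2 = w j := fun j => Real.sq_sqrt (hw.1 j)
  have hsp : ∀ j, 0 < √(w j) := fun j => Real.sqrt_pos.mpr (hpos j)
  have ha1 : ∀ j, √(w j) ≤ 1 := fun j => Real.sqrt_le_one.mpr (simplex_apply_le_one hw j)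
  set W := ∑ j with j ≠ c, w j with hW
  have hWc : w c = 1 - W := by
    have h1 : ∑ k, w k = 1 := hw.2
    rw [hsplit fun k => w k] at h1
    linarith
  have hW0 : 0 ≤ W := Finset.sum_nonneg fun j _ => (hpos j).le
  have hWj : ∀ j, j ≠ c → w j ≤ W := fun j hj =>
    Finset.single_le_sum (f := fun j => w j) (fun i _ => (hpos i).le) (by simp [hj])
  set S := ∑ j with j ≠ c, √(w j) with hS
  have hS0 : 0 ≤ S := Finset.sum_nonneg fun j _ => (hsp j).le
  set q := √W with hq
  set b := √(w c) with hb
  have hb0 : 0 < b := hsp c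
  have hq0 : 0 ≤ q := Real.sqrt_nonneg _
  have hbb : b ^ 2 = w c := hsq c
  have hqq : q ^ 2 = W := Real.sq_sqrt hW0
  have hbq : b ^ 2 + q ^ 2 = 1 := by rw [hbb, hqq, hWc]; ring
  -- The shifted terms.
  have hterm : ∀ j ∈ ({j | j ≠ c} : Finset (Fin K)),
      w c * (√(w j) ^ 3 / (s - √(w j))) ≤ w c * q / s * w j + 2 / s ^ 2 * w j := by
    intro j hj
    have hjc : j ≠ c := by simpa using hj
    have h1 := shifted_term_le (a := √(w j)) (p := w c) (s := s) (hsp j).le (hpos c)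
      (by rw [hsq, add_comm]; exact simplex_add_le_one hw hjc) hs1
    refine h1.trans ?_
    have h2 : √(w j) ≤ q := Real.sqrt_le_sqrt (hWj j hjc)
    have h3 : w c * √(w j) ^ 3 / s ≤ w c * q / s * w j := by
      rw [div_mul_eq_mul_div]
      gcongr ?_ / s
      calc w c * √(w j) ^ 3 = w c * √(w j) * √(w j) ^ 2 := by ring
        _ ≤ w c * q * √(w j) ^ 2 := by
          have := hpos c
          gcongr
        _ = w c * q * w j := by rw [hsq]
    have h4 : 2 * √(w j) ^ 2 / s ^ 2 = 2 / s ^ 2 * w j := by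
      rw [hsq]
      ring
    linarith
  have hshift : w c * ∑ j with j ≠ c, √(w j) ^ 3 / (s - √(w j))
      ≤ w c * q / s * W + 2 / s ^ 2 * W := by
    rw [Finset.mul_sum, hW, Finset.mul_sum, Finset.mul_sum, ← Finset.sum_add_distrib]
    exact Finset.sum_le_sum hterm
  -- The expected stability bound.
  have hstab : ∑ k, w k * stabBound c (t + 1) w k
      ≤ S / s + b * W ^ 2 / s + (w c * q / s * W + 2 / s ^ 2 * W) := by
    rw [hsplit]
    have e1 : ∑ j with j ≠ c, w j * stabBound c (t + 1) w j = S / s := by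
      rw [hS, Finset.sum_div]
      refine Finset.sum_congr rfl fun j hj => ?_
      have hjc : j ≠ c := by simpa using hj
      rw [stabBound, if_neg hjc, ← hsdef]
      nth_rewrite 1 [← hsq j]
      have := (hsp j).ne'
      field_simp
    have e2 : w c * (b ^ 3 * (1 / w c - 1) ^ 2 / s) = b * W ^ 2 / s := by
      have h1 : W = 1 - b ^ 2 := by linarith
      rw [← hbb, h1]
      field_simp
    rw [e1, stabBound, if_pos rfl, ← hsdef, mul_add, ← hb, e2]
    linarith
  have hs0 : 0 < s := by linarith
  -- The terms linear in the weights add up to at most a quarter.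
  have hb1 : b ≤ 1 := ha1 c
  have hpen : W / 2 ≤ 1 - b := by
    have : W = 1 - b ^ 2 := by linarith
    rw [this]
    linarith [sq_nonneg (1 - b), sub_sq 1 b]
  have hlin : b * W ^ 2 + w c * q * W ≤ W * (3 / 4) := by
    have h1 := mul_le_mul_of_nonneg_left (mul_sq_add_sq_mul_le hb0.le hq0 hbq) hW0
    rw [hqq] at h1
    rw [← hbb]
    linarith
  have hrhs : ∑ j with j ≠ c, (4 * √(w j) / s + w j / (2 * s) + 4 * (δ - δ'))
      ≥ 4 * S / s + W / (2 * s) + 4 * (δ - δ') * S := by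
    rw [hS, hW, Finset.mul_sum, Finset.mul_sum, Finset.sum_div, Finset.sum_div,
      ← Finset.sum_add_distrib, ← Finset.sum_add_distrib]
    refine Finset.sum_le_sum fun j _ => ?_
    have : 4 * (δ - δ') * √(w j) ≤ 4 * (δ - δ') * 1 :=
      mul_le_mul_of_nonneg_left (ha1 j) (by linarith)
    linarith
  refine le_trans ?_ (add_le_add_left hrhs _)
  have hW1 : W ≤ 1 := by
    have := hpos c
    linarith
  have hpen2 : 4 * δ * (S - (1 - b)) ≤ 2 * S / s + 4 * (δ - δ') * S - W / s := by
    have h1 : 4 * δ * S ≤ (4 * (1 / (2 * s)) + 4 * (δ - δ')) * S := by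
      gcongr
      linarith
    have h2 : 4 * (1 / (2 * s)) * (W / 2) ≤ 4 * δ * (1 - b) := by
      have hδ0 : 0 ≤ δ := le_trans (by positivity) hd
      gcongr
    have e1 : 4 * (1 / (2 * s)) * S = 2 * S / s := by
      field_simp
      ring
    have e2 : 4 * (1 / (2 * s)) * (W / 2) = W / s := by
      field_simp
      ring
    rw [e2] at h2
    rw [add_mul, e1] at h1
    linarith
  have hlin2 : 2 * (b * W ^ 2 / s + w c * q / s * W) ≤ 3 / 2 * (W / s) := by
    have e1 : 2 * (b * W ^ 2 / s + w c * q / s * W) = 2 * (b * W ^ 2 + w c * q * W) / s := by ring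
    have e2 : 3 / 2 * (W / s) = 2 * (W * (3 / 4)) / s := by ring
    rw [e1, e2]
    gcongr
  have hlast : 2 * (2 / s ^ 2 * W) ≤ 4 / ((t : ℝ) + 1) := by
    rw [hs2, ← mul_assoc, mul_div_assoc']
    norm_num
    exact mul_le_of_le_one_right (by positivity) hW1
  have hhalf : W / (2 * s) = 1 / 2 * (W / s) := by
    field_simp
  rw [roundBound, hsplit, ← hS, ← hb, ← hsdef, ← hδ, hhalf]
  have e3 : 4 * S / s = 2 * (S / s) + 2 * S / s := by ring
  rw [e3]
  linarith

/-- Completing the square in the contribution of one arm with gap `D`, at `s = √t`. -/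
theorem arm_term_le {u D s : ℝ} (hu0 : 0 ≤ u) (hu1 : u ≤ 1) (hD : 0 < D) (hs : 0 < s) :
    4 * √u / s + u / (2 * s) - D * u
      ≤ 4 / s ^ 2 / D + if D * s ≤ 2 then 1 / (2 * s) else 8 / 3 / (s ^ 3 * D ^ 2) := by
  have hg := Real.sq_sqrt hu0
  set g := √u with hgdef
  rw [← hg]
  rw [← hg] at hu1
  have hsquare : ∀ E : ℝ, 0 < E → 4 * g / s - E * g ^ 2 ≤ 4 / s ^ 2 / E := by
    intro E hE
    rw [le_div_iff₀ hE]
    have e : 4 / s ^ 2 - (4 * g / s - E * g ^ 2) * E = (2 / s - E * g) ^ 2 := by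
      field_simp
      ring
    nlinarith [sq_nonneg (2 / s - E * g)]
  split_ifs with h
  · have h1 := hsquare D hD
    have h2 : g ^ 2 / (2 * s) ≤ 1 / (2 * s) := by gcongr
    linarith
  · push Not at h
    have hE : 0 < D - 1 / (2 * s) := by
      rw [sub_pos, div_lt_iff₀ (by positivity)]
      nlinarith
    have h1 := hsquare _ hE
    have h2 : 4 / s ^ 2 / (D - 1 / (2 * s)) ≤ 4 / s ^ 2 / D + 8 / 3 / (s ^ 3 * D ^ 2) := by
      obtain ⟨m, rfl⟩ : ∃ m, D = (m + 1) / (2 * s) := ⟨2 * D * s - 1, by field_simp; ring⟩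
      have hm : 3 < m := by
        have : (m + 1) / (2 * s) * s = (m + 1) / 2 := by field_simp
        linarith
      have h3 : (m + 1) / (2 * s) - 1 / (2 * s) = m / (2 * s) := by ring
      rw [h3, ← sub_nonneg]
      have e : 4 / s ^ 2 / ((m + 1) / (2 * s)) + 8 / 3 / (s ^ 3 * ((m + 1) / (2 * s)) ^ 2)
          - 4 / s ^ 2 / (m / (2 * s)) = 8 / 3 * (m - 3) / (s * m * (m + 1) ^ 2) := by
        field_simp
        ring
      rw [e]
      have : 0 < m - 3 := by linarith
      positivity
    have e : g ^ 2 / (2 * s) = 1 / (2 * s) * g ^ 2 := by ring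
    rw [e]
    linarith

/-- The excess terms of one arm sum to `O(1 / D)`: those before time `4 / D²` are at most the
increments of `√t`, the later ones are at most the increments of `- 16 / (3 D² √t)`. -/
theorem sum_arm_excess_le {D : ℝ} (hD : 0 < D) (hD1 : D ≤ 1) (T : ℕ) :
    ∑ t ∈ Finset.range T, (if D * √((t + 1 : ℕ) : ℝ) ≤ 2 then 1 / (2 * √((t + 1 : ℕ) : ℝ))
        else 8 / 3 / (√((t + 1 : ℕ) : ℝ) ^ 3 * D ^ 2))
      ≤ if D * √(T : ℝ) ≤ 2 then √(T : ℝ) else 5 / D - 16 / 3 / (D ^ 2 * √(T : ℝ)) := by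
  induction T with
  | zero => simp
  | succ n ih =>
    rw [Finset.sum_range_succ]
    have hinc := sqrt_increment_ge n
    have hr0 : 0 ≤ √(n : ℝ) := Real.sqrt_nonneg _
    have hs0 : 0 < √((n + 1 : ℕ) : ℝ) := Real.sqrt_pos.mpr (by positivity)
    generalize √((n + 1 : ℕ) : ℝ) = s at *
    generalize √(n : ℝ) = r at *
    have hrs : r ≤ s := by
      have : 0 < 1 / (2 * s) := by positivity
      linarith
    by_cases h1 : D * s ≤ 2
    · have h2 : D * r ≤ 2 := le_trans (by gcongr) h1
      rw [if_pos h2] at ih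
      rw [if_pos h1, if_pos h1]
      linarith
    · rw [if_neg h1, if_neg h1]
      push Not at h1
      have hs1 : 2 / D < s := by
        rw [div_lt_iff₀ hD]
        linarith
      by_cases h2 : D * r ≤ 2
      · rw [if_pos h2] at ih
        have h3 : r ≤ 2 / D := by
          rw [le_div_iff₀ hD]
          linarith
        have h4 : 8 / 3 / (s ^ 3 * D ^ 2) ≤ 1 / (3 * D) := by
          have h5 : 2 ^ 3 ≤ (D * s) ^ 3 := by gcongr
          rw [div_div, div_le_div_iff₀ (by positivity) (by positivity)]
          have h6 : 8 ≤ s ^ 3 * D ^ 2 * 1 := by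
            calc (8 : ℝ) ≤ s ^ 3 * D ^ 2 * D := by nlinarith
              _ ≤ s ^ 3 * D ^ 2 * 1 := by gcongr
          nlinarith
        have h7 : 16 / 3 / (D ^ 2 * s) ≤ 8 / (3 * D) := by
          rw [div_div, div_le_div_iff₀ (by positivity) (by positivity)]
          nlinarith [mul_pos hD (sub_pos.2 h1)]
        have e : 5 / D = 2 / D + 1 / (3 * D) + 8 / (3 * D) := by
          field_simp
          norm_num
        linarith
      · rw [if_neg h2] at ih
        push Not at h2
        have hr1 : 0 < r := by
          by_contra hc
          nlinarith
        have h3 : 8 / 3 / (s ^ 3 * D ^ 2) ≤ 16 / 3 / (D ^ 2 * r) - 16 / 3 / (D ^ 2 * s) := by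
          have e : 16 / 3 / (D ^ 2 * r) - 16 / 3 / (D ^ 2 * s)
              = 16 / 3 / D ^ 2 * ((s - r) / (r * s)) := by
            field_simp
          have e2 : 8 / 3 / (s ^ 3 * D ^ 2) = 16 / 3 / D ^ 2 * (1 / (2 * s) / (s * s)) := by
            field_simp
            norm_num
          rw [e, e2]
          gcongr
        linarith

theorem sum_inv_le {T : ℕ} : ∑ t ∈ Finset.range T, 1 / ((t : ℝ) + 1) ≤ 1 + Real.log T := by
  have h := harmonic_le_one_add_log T
  rw [harmonic] at h
  push_cast at h
  simpa using h

/-- The total contribution of one arm with gap `D`. The increments of `√t` exceed their first order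
approximation by summable amounts, which telescope. -/
theorem sum_arm_le {T : ℕ} {D : ℝ} (hD : 0 < D) (hD1 : D ≤ 1 / 2) {u : Fin T → ℝ}
    (hu0 : ∀ t, 0 ≤ u t) (hu1 : ∀ t, u t ≤ 1) :
    ∑ t : Fin T, (4 * √(u t) / √((t + 1 : ℕ) : ℝ) + u t / (2 * √((t + 1 : ℕ) : ℝ))
        + 4 * ((√((t + 1 : ℕ) : ℝ) - √((t : ℕ) : ℝ))
          - (√((t + 1 + 1 : ℕ) : ℝ) - √((t + 1 : ℕ) : ℝ))) - D * u t)
      ≤ (4 * Real.log T + 12) / D := by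
  have h1 : ∀ t : Fin T, 4 * √(u t) / √((t + 1 : ℕ) : ℝ) + u t / (2 * √((t + 1 : ℕ) : ℝ))
        + 4 * ((√((t + 1 : ℕ) : ℝ) - √((t : ℕ) : ℝ))
          - (√((t + 1 + 1 : ℕ) : ℝ) - √((t + 1 : ℕ) : ℝ))) - D * u t
      ≤ 4 / D * (1 / (((t : ℕ) : ℝ) + 1))
        + (if D * √((t + 1 : ℕ) : ℝ) ≤ 2 then 1 / (2 * √((t + 1 : ℕ) : ℝ))
          else 8 / 3 / (√((t + 1 : ℕ) : ℝ) ^ 3 * D ^ 2))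
        + 4 * ((√((t + 1 : ℕ) : ℝ) - √((t : ℕ) : ℝ))
          - (√((t + 1 + 1 : ℕ) : ℝ) - √((t + 1 : ℕ) : ℝ))) := by
    intro t
    have h := arm_term_le (hu0 t) (hu1 t) hD
      (Real.sqrt_pos.mpr (by positivity : (0 : ℝ) < ((t + 1 : ℕ) : ℝ)))
    have e : 4 / √((t + 1 : ℕ) : ℝ) ^ 2 / D = 4 / D * (1 / (((t : ℕ) : ℝ) + 1)) := by
      rw [Real.sq_sqrt (by positivity)]
      push_cast
      field_simp
    rw [e] at h
    linarith
  refine (Finset.sum_le_sum fun t _ => h1 t).trans ?_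
  rw [Fin.sum_univ_eq_sum_range (fun t : ℕ => 4 / D * (1 / ((t : ℝ) + 1))
        + (if D * √((t + 1 : ℕ) : ℝ) ≤ 2 then 1 / (2 * √((t + 1 : ℕ) : ℝ))
          else 8 / 3 / (√((t + 1 : ℕ) : ℝ) ^ 3 * D ^ 2))
        + 4 * ((√((t + 1 : ℕ) : ℝ) - √(t : ℝ))
          - (√((t + 1 + 1 : ℕ) : ℝ) - √((t + 1 : ℕ) : ℝ)))) T,
    Finset.sum_add_distrib, Finset.sum_add_distrib, ← Finset.mul_sum, ← Finset.mul_sum]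
  have h2 := sum_arm_excess_le hD (by linarith) T
  have h3 : (if D * √(T : ℝ) ≤ 2 then √(T : ℝ) else 5 / D - 16 / 3 / (D ^ 2 * √(T : ℝ)))
      ≤ 5 / D := by
    split_ifs with h
    · rw [le_div_iff₀ hD]
      linarith
    · have : 0 ≤ 16 / 3 / (D ^ 2 * √(T : ℝ)) := by positivity
      linarith
  have h4 : 4 / D * ∑ t ∈ Finset.range T, 1 / ((t : ℝ) + 1) ≤ 4 / D * (1 + Real.log T) := by
    gcongr
    exact sum_inv_le
  have h5 : ∑ t ∈ Finset.range T, ((√((t + 1 : ℕ) : ℝ) - √(t : ℝ))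
      - (√((t + 1 + 1 : ℕ) : ℝ) - √((t + 1 : ℕ) : ℝ))) ≤ 1 := by
    rw [Finset.sum_range_sub' fun t : ℕ => √((t + 1 : ℕ) : ℝ) - √(t : ℝ)]
    have : √(T : ℝ) ≤ √((T + 1 : ℕ) : ℝ) := Real.sqrt_le_sqrt (by simp)
    simp at this ⊢
    linarith
  have h6 : 4 ≤ 2 / D := by
    rw [le_div_iff₀ hD]
    linarith
  have e : (4 * Real.log T + 12) / D = 4 / D * (1 + Real.log T) + 5 / D + 2 / D + 1 / D := by
    field_simp
    ring
  have : 0 < 1 / D := by positivity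
  linarith

/-- The sum of the round bounds, minus the lower bound that self-bounding provides, is logarithmic
along every sequence of weights. -/
theorem sum_roundBound_le {K T : ℕ} (c : Fin K) {D : Fin K → ℝ} (hD0 : ∀ k, k ≠ c → 0 < D k)
    (hD1 : ∀ k, D k ≤ 1 / 2) {w : Fin T → Vec K} (hw : ∀ t, w t ∈ simplex K)
    (hpos : ∀ t k, 0 < w t k) :
    ∑ t : Fin T, (2 * roundBound c t (w t) - ∑ k with k ≠ c, w t k * D k)
      ≤ ∑ k with k ≠ c, (4 * Real.log T + 12) / D k + (4 * Real.log T + 4) := by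
  have h1 : ∀ t : Fin T, 2 * roundBound c t (w t) - ∑ k with k ≠ c, w t k * D k
      ≤ ∑ k with k ≠ c, (4 * √(w t k) / √((t + 1 : ℕ) : ℝ) + w t k / (2 * √((t + 1 : ℕ) : ℝ))
        + 4 * ((√((t + 1 : ℕ) : ℝ) - √((t : ℕ) : ℝ))
          - (√((t + 1 + 1 : ℕ) : ℝ) - √((t + 1 : ℕ) : ℝ))) - D k * w t k)
        + 4 * (1 / (((t : ℕ) : ℝ) + 1)) := by
    intro t
    have h := two_mul_roundBound_le c t (hw t) (hpos t)
    rw [Finset.sum_sub_distrib]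
    simp only [mul_comm (D _)]
    rw [mul_one_div]
    linarith
  refine (Finset.sum_le_sum fun t _ => h1 t).trans ?_
  rw [Finset.sum_add_distrib, Finset.sum_comm, ← Finset.mul_sum]
  refine add_le_add (Finset.sum_le_sum fun k hk => ?_) ?_
  · exact sum_arm_le (hD0 k (by simpa using hk)) (hD1 k) (fun t => (hpos t k).le)
      fun t => simplex_apply_le_one (hw t) k
  · rw [Fin.sum_univ_eq_sum_range (fun t : ℕ => 1 / ((t : ℝ) + 1)) T]
    have := sum_inv_le (T := T)
    linarith

/-! ### Expectations over the run of the algorithm -/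

theorem sum_bind_toReal {α β : Type} [Fintype α] [Fintype β] (p : PMF α) (q : α → PMF β)
    (f : β → ℝ) :
    ∑ b, (p.bind q b).toReal * f b = ∑ a, (p a).toReal * ∑ b, (q a b).toReal * f b := by
  have h : ∀ b, (p.bind q b).toReal = ∑ a, (p a).toReal * (q a b).toReal := fun b => by
    rw [PMF.bind_apply, tsum_fintype, ENNReal.toReal_sum fun a _ =>
      ENNReal.mul_ne_top (p.apply_ne_top a) ((q a).apply_ne_top b)]
    simp only [ENNReal.toReal_mul]
  simp only [h, Finset.sum_mul, Finset.mul_sum]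
  rw [Finset.sum_comm]
  exact Finset.sum_congr rfl fun a _ => Finset.sum_congr rfl fun b _ => by ring

theorem sum_pure_toReal {α : Type} [Fintype α] (a : α) (f : α → ℝ) :
    ∑ b, (PMF.pure a b).toReal * f b = f a := by
  classical
  rw [Finset.sum_eq_single a]
  · simp
  · intro b _ hb
    simp [PMF.pure_apply_of_ne a b hb]
  · simp

theorem sum_map_toReal {α β : Type} [Fintype α] [Fintype β] (p : PMF α) (g : α → β) (f : β → ℝ) :
    ∑ b, (p.map g b).toReal * f b = ∑ a, (p a).toReal * f (g a) := by
  rw [← PMF.bind_pure_comp, sum_bind_toReal]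
  simp only [Function.comp_apply, sum_pure_toReal]

theorem lawOf_toReal {α : Type} [Fintype α] (q : α → ℝ) (h0 : ∀ a, 0 ≤ q a) (h1 : ∑ a, q a = 1)
    (a : α) : (lawOf q h0 h1 a).toReal = q a := by
  rw [lawOf, PMF.ofFintype_apply, ENNReal.toReal_ofReal (h0 a)]

theorem armLaw_toReal {K : ℕ} [NeZero K] (i : Player) (t : ℕ) (h : Fin t → Round K) (k : Fin K) :
    (armLaw i t h k).toReal = play i t h k :=
  lawOf_toReal _ _ _ k

theorem duelLaw_toReal {K : ℕ} (P : PreferenceMatrix K) (a b : Fin K) (x : Bool) :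
    (duelLaw P a b x).toReal = if x then P.prob a b else P.prob b a :=
  lawOf_toReal _ _ _ x

/-- The conditional expectation of a function of the next round, given that the players draw their
arms from `p` and `q`. -/
noncomputable def roundMean {K : ℕ} (P : PreferenceMatrix K) (p q : Vec K) (g : Round K → ℝ) : ℝ :=
  ∑ a, p a * ∑ b, q b * (P.prob a b * g ((a, b), true) + P.prob b a * g ((a, b), false))

theorem expect_zero {K : ℕ} [NeZero K] (P : PreferenceMatrix K) (f : (Fin 0 → Round K) → ℝ) :
    expect P 0 f = f Fin.elim0 := by
  rw [expect, run, sum_pure_toReal]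

/-- The tower property for the last round. -/
theorem expect_succ {K : ℕ} [NeZero K] (P : PreferenceMatrix K) (T : ℕ)
    (f : (Fin (T + 1) → Round K) → ℝ) :
    expect P (T + 1) f = expect P T fun h =>
      roundMean P (play .plus T h) (play .minus T h) fun r => f (Fin.snoc h r) := by
  simp only [expect, run, sum_bind_toReal, sum_map_toReal, armLaw_toReal, duelLaw_toReal,
    roundMean, Fintype.sum_bool]
  simp

section Linearity

variable {K : ℕ} (P : PreferenceMatrix K)

theorem roundMean_add (p q : Vec K) (g g' : Round K → ℝ) :
    roundMean P p q (fun r => g r + g' r) = roundMean P p q g + roundMean P p q g' := by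
  simp only [roundMean, ← Finset.sum_add_distrib, ← mul_add]
  exact Finset.sum_congr rfl fun a _ => congrArg _ <| Finset.sum_congr rfl fun b _ => by ring

theorem roundMean_mul (p q : Vec K) (x : ℝ) (g : Round K → ℝ) :
    roundMean P p q (fun r => x * g r) = x * roundMean P p q g := by
  simp only [roundMean, Finset.mul_sum]
  exact Finset.sum_congr rfl fun a _ => Finset.sum_congr rfl fun b _ => by ring

theorem roundMean_mono {p q : Vec K} (hp : p ∈ simplex K) (hq : q ∈ simplex K)
    {g g' : Round K → ℝ} (h : ∀ r, g r ≤ g' r) : roundMean P p q g ≤ roundMean P p q g' := by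
  refine Finset.sum_le_sum fun a _ => mul_le_mul_of_nonneg_left
    (Finset.sum_le_sum fun b _ => mul_le_mul_of_nonneg_left ?_ (hq.1 b)) (hp.1 a)
  exact add_le_add (mul_le_mul_of_nonneg_left (h _) (P.nonneg a b))
    (mul_le_mul_of_nonneg_left (h _) (P.nonneg b a))

theorem roundMean_arms {p q : Vec K} (hp : p ∈ simplex K) (hq : q ∈ simplex K) (f g : Fin K → ℝ) :
    roundMean P p q (fun r => f (arm .plus r) + g (arm .minus r))
      = ∑ k, p k * f k + ∑ k, q k * g k := by
  have h1 : ∑ k, p k = 1 := hp.2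
  have h2 : ∑ k, q k = 1 := hq.2
  have h3 : ∀ a, ∑ b, q b * (P.prob a b * (f a + g b) + P.prob b a * (f a + g b))
      = f a + ∑ k, q k * g k := fun a => by
    have : ∀ b, q b * (P.prob a b * (f a + g b) + P.prob b a * (f a + g b))
        = q b * f a + q b * g b := fun b => by
      rw [← add_mul, P.add_swap]
      ring
    simp only [this, Finset.sum_add_distrib, ← Finset.sum_mul, h2, one_mul]
  simp only [roundMean, arm, h3]
  simp only [mul_add, Finset.sum_add_distrib, ← Finset.sum_mul, h1, one_mul]

theorem roundMean_const {p q : Vec K} (hp : p ∈ simplex K) (hq : q ∈ simplex K) (x : ℝ) :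
    roundMean P p q (fun _ => x) = x := by
  have h1 : ∑ k, p k = 1 := hp.2
  have := roundMean_arms P hp hq (fun _ => x) fun _ => 0
  simpa [← Finset.sum_mul, h1] using this

variable [NeZero K]

theorem expect_add (T : ℕ) (f g : (Fin T → Round K) → ℝ) :
    expect P T (fun h => f h + g h) = expect P T f + expect P T g := by
  simp only [expect, mul_add, Finset.sum_add_distrib]

theorem expect_mul (T : ℕ) (x : ℝ) (f : (Fin T → Round K) → ℝ) :
    expect P T (fun h => x * f h) = x * expect P T f := by
  simp only [expect, Finset.mul_sum]
  exact Finset.sum_congr rfl fun a _ => by ring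

theorem expect_mono (T : ℕ) {f g : (Fin T → Round K) → ℝ} (h : ∀ x, f x ≤ g x) :
    expect P T f ≤ expect P T g :=
  Finset.sum_le_sum fun x _ => mul_le_mul_of_nonneg_left (h x) ENNReal.toReal_nonneg

theorem play_mem_simplex (i : Player) (t : ℕ) (h : Fin t → Round K) : play i t h ∈ simplex K :=
  weights_mem_simplex t.succ_pos _

theorem expect_const (T : ℕ) (x : ℝ) : expect P T (fun _ => x) = x := by
  induction T with
  | zero => rw [expect_zero]
  | succ n ih =>
    rw [expect_succ]
    simpa only [roundMean_const P (play_mem_simplex _ _ _) (play_mem_simplex _ _ _)] using ih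

/-- Adding up conditional expectations: if every round adds to `f` a function of the history and
the round, the expectation grows by the expected conditional mean of that function. -/
theorem expect_succ_of_snoc (T : ℕ) {f : (Fin (T + 1) → Round K) → ℝ}
    {f' : (Fin T → Round K) → ℝ} {g : (Fin T → Round K) → Round K → ℝ}
    (h : ∀ x r, f (Fin.snoc x r) = f' x + g x r) :
    expect P (T + 1) f = expect P T f'
      + expect P T fun x => roundMean P (play .plus T x) (play .minus T x) (g x) := by
  rw [expect_succ, ← expect_add]
  simp only [h, roundMean_add,
    roundMean_const P (play_mem_simplex _ _ _) (play_mem_simplex _ _ _)]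

end Linearity

/-- The sum over the rounds of a function of the time and of the weights of player `i`. -/
noncomputable def playSum {K T : ℕ} (i : Player) (F : ℕ → Vec K → ℝ) (h : Fin T → Round K) : ℝ :=
  ∑ t : Fin T, F t (play i t (Fin.take t t.is_lt.le h))

theorem playSum_snoc {K T : ℕ} (i : Player) (F : ℕ → Vec K → ℝ) (h : Fin T → Round K)
    (r : Round K) :
    playSum i F (Fin.snoc h r : Fin (T + 1) → Round K) = playSum i F h + F T (play i T h) := by
  rw [playSum, Fin.sum_univ_castSucc]
  congr 1
  · refine Finset.sum_congr rfl fun t _ => ?_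
    have e : Fin.take (t.castSucc : ℕ) t.castSucc.is_lt.le (Fin.snoc h r : Fin (T + 1) → Round K)
        = Fin.take (t : ℕ) t.is_lt.le h := by
      funext s
      exact Fin.snoc_castSucc (α := fun _ => Round K) r h (Fin.castLE t.is_lt.le s)
    exact congrArg (fun x => F t (play i t x)) e
  · have e : Fin.take (Fin.last T : ℕ) (Fin.last T).is_lt.le (Fin.snoc h r : Fin (T + 1) → Round K)
        = h := by
      funext s
      exact Fin.snoc_castSucc (α := fun _ => Round K) r h s
    exact congrArg (fun x => F T (play i T x)) e

theorem cumEst_snoc {K T : ℕ} (i : Player) (h : Fin T → Round K) (r : Round K) :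
    cumEst i (T + 1) (Fin.snoc h r : Fin (T + 1) → Round K)
      = cumEst i T h + lossEst i (play i T h) r := by
  simp only [cumEst, Fin.init_snoc, Fin.snoc_last, play]

theorem regret_snoc {K T : ℕ} (P : PreferenceMatrix K) (k : Fin K) (h : Fin T → Round K)
    (r : Round K) :
    regret P k (Fin.snoc h r : Fin (T + 1) → Round K)
      = regret P k h + 1 / 2 * (P.prob k (arm .plus r) + P.prob k (arm .minus r) - 1) := by
  simp only [regret, Fin.sum_univ_castSucc, Fin.snoc_castSucc, Fin.snoc_last]

theorem weightedGapSum_eq {K : ℕ} [NeZero K] (P : PreferenceMatrix K) (T : ℕ) (D : Fin K → ℝ)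
    (c : Fin K) :
    weightedGapSum P T D c
      = 1 / 2 * (expect P T (playSum .plus fun _ w => ∑ k with k ≠ c, w k * D k)
      + expect P T (playSum .minus fun _ w => ∑ k with k ≠ c, w k * D k)) := by
  rw [weightedGapSum, ← expect_add]
  simp only [playSum, playProb, ← Finset.sum_add_distrib, add_mul]

theorem prob_self {K : ℕ} (P : PreferenceMatrix K) (k : Fin K) : P.prob k k = 1 / 2 := by
  linarith [P.add_swap k k]

theorem expect_playSum_succ {K : ℕ} [NeZero K] (P : PreferenceMatrix K) (T : ℕ) (i : Player)
    (F : ℕ → Vec K → ℝ) :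
    expect P (T + 1) (playSum i F)
      = expect P T (playSum i F) + expect P T fun h => F T (play i T h) := by
  rw [expect_succ_of_snoc P T fun h r => playSum_snoc i F h r]
  simp only [roundMean_const P (play_mem_simplex _ _ _) (play_mem_simplex _ _ _)]

/-- The expected regret against the Condorcet winner, in terms of the weights. -/
theorem expect_regret_eq {K : ℕ} [NeZero K] (P : PreferenceMatrix K) (c : Fin K) (T : ℕ) :
    expect P T (regret P c) = weightedGapSum P T (gap P c) c := by
  rw [weightedGapSum_eq]
  induction T with
  | zero => simp [expect_zero, regret, playSum]
  | succ n ih =>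
    rw [expect_succ_of_snoc P n fun h r => regret_snoc P c h r, expect_playSum_succ,
      expect_playSum_succ, ih]
    have hsum : ∀ p : Vec K, ∑ k, p k * (1 / 2 * gap P c k)
        = 1 / 2 * ∑ k with k ≠ c, p k * gap P c k := fun p => by
      rw [Finset.filter_ne', ← Finset.add_sum_erase _ _ (Finset.mem_univ c), Finset.mul_sum]
      have h0 : gap P c c = 0 := by rw [gap, prob_self, sub_self]
      rw [h0, mul_zero, mul_zero, zero_add]
      exact Finset.sum_congr rfl fun k _ => by ring
    have hmean : ∀ h : Fin n → Round K, roundMean P (play .plus n h) (play .minus n h)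
        (fun r => 1 / 2 * (P.prob c (arm .plus r) + P.prob c (arm .minus r) - 1))
        = 1 / 2 * (∑ k with k ≠ c, play .plus n h k * gap P c k
          + ∑ k with k ≠ c, play .minus n h k * gap P c k) := fun h => by
      rw [mul_add, ← hsum, ← hsum, ← roundMean_arms P (play_mem_simplex _ _ _)
        (play_mem_simplex _ _ _)]
      congr 1
      funext r
      simp only [gap]
      ring
    simp only [hmean, expect_mul, expect_add]
    ring

/-! ### The regret bound of one player -/

theorem loss_mem_Icc {K : ℕ} (i : Player) (r : Round K) : loss i r ∈ Set.Icc (0 : ℝ) 1 := by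
  cases i <;> simp only [loss, outcome] <;> split_ifs <;> norm_num

/-- The accumulated losses of a player plus the current conjugate: the potential of the analysis of
follow the regularized leader. -/
noncomputable def potential {K T : ℕ} (i : Player) (h : Fin T → Round K) : ℝ :=
  ∑ t, loss i (h t) + conjSimplex (tsallis T) (-cumEst i T h)

theorem potential_zero {K : ℕ} [NeZero K] (i : Player) (h : Fin 0 → Round K) :
    potential i h ≤ 0 := by
  simp only [potential, cumEst, Finset.univ_eq_empty, Finset.sum_empty, zero_add]
  exact conjSimplex_le 0 0 fun w _ => by simp [tsallis]

/-- The comparison with the vertex `k` of the simplex. -/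
theorem le_potential {K T : ℕ} (i : Player) (h : Fin T → Round K) (k : Fin K) :
    ∑ t, loss i (h t) - cumEst i T h k + √(T : ℝ) ≤ potential i h := by
  have hv : (WithLp.toLp 2 (Pi.single k 1) : Vec K) ∈ simplex K := single_mem_stdSimplex ℝ k
  have h1 := le_conjSimplex T (cumEst i T h) hv
  rw [tsallis_eq T hv] at h1
  have e1 : ∑ j, cumEst i T h j * (WithLp.toLp 2 (Pi.single k 1) : Vec K) j = cumEst i T h k := by
    simp [Pi.single_apply]
  have e2 : ∑ j, √((WithLp.toLp 2 (Pi.single k 1) : Vec K) j) = 1 := by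
    have : ∀ j, √((Pi.single k 1 : Fin K → ℝ) j) = (Pi.single k 1 : Fin K → ℝ) j := fun j => by
      by_cases hj : j = k
      · subst hj
        simp
      · simp [hj]
    simp only [this]
    simp
  rw [e1, e2] at h1
  rw [potential]
  linarith

/-- Changing the regularizer from one round to the next. -/
theorem conjSimplex_succ_le {K : ℕ} [NeZero K] (t : ℕ) (L : Vec K) :
    conjSimplex (tsallis (t + 1)) (-L) ≤ conjSimplex (tsallis t) (-L)
      + (√((t + 1 : ℕ) : ℝ) - √(t : ℝ)) * (2 * ∑ k, √(weights (t + 1) L k) - 1) := by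
  have hw := weights_mem_simplex t.succ_pos L
  have h1 := le_conjSimplex t L hw
  rw [conjSimplex_eq t.succ_pos, tsallis_eq _ hw]
  rw [tsallis_eq _ hw] at h1
  linarith

/-- The growth of the potential in one round: penalty plus stability. -/
theorem potential_snoc_le {K T : ℕ} [NeZero K] (i : Player) (c : Fin K) (h : Fin T → Round K)
    (r : Round K) :
    potential i (Fin.snoc h r : Fin (T + 1) → Round K) ≤ potential i h
      + ((√((T + 1 : ℕ) : ℝ) - √(T : ℝ)) * (2 * ∑ k, √(play i T h k) - 1)
        + stabBound c (T + 1) (play i T h) (arm i r)) := by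
  have h1 := stability_le T.succ_pos (cumEst i T h) c (arm i r) (loss_mem_Icc i r).1
    (loss_mem_Icc i r).2
  have h2 := conjSimplex_succ_le T (cumEst i T h)
  simp only [potential, Fin.sum_univ_castSucc, Fin.snoc_castSucc, Fin.snoc_last, cumEst_snoc]
  simp only [play, lossEst]
  simp only [Nat.succ_eq_add_one] at h1
  linarith

theorem roundMean_arm {K : ℕ} (P : PreferenceMatrix K) {p : Player → Vec K}
    (hp : ∀ i, p i ∈ simplex K) (i : Player) (f : Fin K → ℝ) :
    roundMean P (p .plus) (p .minus) (fun r => f (arm i r)) = ∑ k, p i k * f k := by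
  cases i
  · simpa using roundMean_arms P (hp .plus) (hp .minus) f fun _ => 0
  · simpa using roundMean_arms P (hp .plus) (hp .minus) (fun _ => 0) f

theorem expect_potential_le {K : ℕ} [NeZero K] (P : PreferenceMatrix K) (i : Player) (c : Fin K)
    (T : ℕ) :
    expect P T (potential i) ≤ expect P T (playSum i (roundBound c)) + √(T : ℝ) := by
  induction T with
  | zero =>
    rw [expect_zero, expect_zero]
    simpa [playSum] using potential_zero i (Fin.elim0 : Fin 0 → Round K)
  | succ n ih =>
    set δ := √((n + 1 : ℕ) : ℝ) - √(n : ℝ) with hδ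
    have h1 : expect P (n + 1) (potential i) ≤ expect P n (potential i)
        + expect P n fun h => δ + roundBound c n (play i n h) := by
      rw [expect_succ, ← expect_add]
      refine expect_mono P n fun h => ?_
      refine (roundMean_mono P (play_mem_simplex _ _ _) (play_mem_simplex _ _ _)
        fun r => potential_snoc_le i c h r).trans (le_of_eq ?_)
      rw [roundMean_add, roundMean_add, roundMean_arm P (p := fun i => play i n h)
        (fun i => play_mem_simplex i n h) i,
        roundMean_const P (play_mem_simplex _ _ _) (play_mem_simplex _ _ _),
        roundMean_const P (play_mem_simplex _ _ _) (play_mem_simplex _ _ _), roundBound, ← hδ]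
      ring
    rw [expect_add, expect_const] at h1
    rw [expect_playSum_succ]
    linarith

/-! ### Unbiasedness and the two players together -/

/-- The two estimated regrets of the players have the regret of the duel as conditional mean. -/
theorem roundMean_loss_sub_lossEst {K : ℕ} (P : PreferenceMatrix K) {p q : Vec K}
    (hp : p ∈ simplex K) (hq : q ∈ simplex K) (k : Fin K) (hpk : 0 < p k) (hqk : 0 < q k) :
    roundMean P p q (fun r => (loss .plus r - lossEst .plus p r k)
        + (loss .minus r - lossEst .minus q r k))
      = roundMean P p q fun r => P.prob k (arm .plus r) + P.prob k (arm .minus r) - 1 := by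
  have h1 : ∑ k, p k = 1 := hp.2
  have h2 : ∑ k, q k = 1 := hq.2
  -- The mean of a loss given the two arms, also when they coincide.
  have hplus : ∀ a b, P.prob a b * loss .plus ((a, b), true)
      + P.prob b a * loss .plus ((a, b), false) = P.prob b a := fun a b => by
    simp only [loss, outcome]
    split_ifs with h
    · rw [h, prob_self]
      norm_num
    · simp at *
    · simp
  have hminus : ∀ a b, P.prob a b * loss .minus ((a, b), true)
      + P.prob b a * loss .minus ((a, b), false) = P.prob a b := fun a b => by
    simp only [loss, outcome]
    split_ifs with h
    · rw [h, prob_self]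
      norm_num
    · simp at *
    · simp
  have e1 : roundMean P p q (fun r => lossEst .plus p r k) = ∑ b, q b * P.prob b k := by
    have : ∀ a b, P.prob a b * lossEst .plus p ((a, b), true) k
        + P.prob b a * lossEst .plus p ((a, b), false) k
        = if k = a then P.prob b a / p k else 0 := fun a b => by
      have hl : ∀ x, lossEst .plus p ((a, b), x) k
          = if k = a then loss .plus ((a, b), x) / p k else 0 := fun _ => rfl
      rw [hl, hl]
      split_ifs with h
      · rw [mul_div_assoc', mul_div_assoc', ← add_div, hplus]
      · simp
    simp only [roundMean, this, mul_ite, mul_zero]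
    rw [Finset.sum_eq_single k]
    · simp only [if_true, Finset.mul_sum]
      exact Finset.sum_congr rfl fun b _ => by field_simp
    · intro a _ ha
      simp [ha.symm]
    · simp
  have e2 : roundMean P p q (fun r => lossEst .minus q r k) = ∑ a, p a * P.prob a k := by
    have : ∀ a b, P.prob a b * lossEst .minus q ((a, b), true) k
        + P.prob b a * lossEst .minus q ((a, b), false) k
        = if k = b then P.prob a b / q k else 0 := fun a b => by
      have hl : ∀ x, lossEst .minus q ((a, b), x) k
          = if k = b then loss .minus ((a, b), x) / q k else 0 := fun _ => rfl
      rw [hl, hl]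
      split_ifs with h
      · rw [mul_div_assoc', mul_div_assoc', ← add_div, hminus]
      · simp
    simp only [roundMean, this, mul_ite, mul_zero, Finset.sum_ite_eq, Finset.mem_univ, if_true]
    exact Finset.sum_congr rfl fun a _ => by field_simp
  have e3 : ∀ r : Round K, (loss .plus r - lossEst .plus p r k)
      + (loss .minus r - lossEst .minus q r k)
      = 1 + (-1) * (lossEst .plus p r k + lossEst .minus q r k) := fun r => by
    simp only [loss]
    ring
  have e4 : ∀ r : Round K, P.prob k (arm .plus r) + P.prob k (arm .minus r) - 1
      = 1 + (-1) * (P.prob (arm .plus r) k + P.prob (arm .minus r) k) := fun r => by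
    linarith [P.add_swap k (arm .plus r), P.add_swap k (arm .minus r)]
  simp only [e3, e4]
  rw [roundMean_add, roundMean_add, roundMean_mul, roundMean_mul, roundMean_add, e1, e2,
    roundMean_arms P hp hq (fun a => P.prob a k) fun a => P.prob a k]
  ring

/-- The expected regret is the average of the two players' expected regrets for the estimated
losses. -/
theorem expect_regret_eq_estimated {K : ℕ} [NeZero K] (P : PreferenceMatrix K) (k : Fin K)
    (T : ℕ) :
    expect P T (regret P k) = 1 / 2 * expect P T fun h =>
      (∑ t, loss .plus (h t) - cumEst .plus T h k)
        + (∑ t, loss .minus (h t) - cumEst .minus T h k) := by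
  induction T with
  | zero => simp [expect_zero, regret, cumEst]
  | succ n ih =>
    rw [expect_succ_of_snoc P n fun h r => regret_snoc P k h r, ih,
      expect_succ_of_snoc P n (f' := fun h => (∑ t, loss .plus (h t) - cumEst .plus n h k)
          + (∑ t, loss .minus (h t) - cumEst .minus n h k))
        (g := fun h r => (loss .plus r - lossEst .plus (play .plus n h) r k)
          + (loss .minus r - lossEst .minus (play .minus n h) r k))
        (fun h r => by
          simp only [Fin.sum_univ_castSucc, Fin.snoc_castSucc, Fin.snoc_last, cumEst_snoc,
            PiLp.add_apply]
          ring),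
      mul_add, ← expect_mul P n _ (fun x => roundMean _ _ _ _)]
    congr 2
    funext h
    rw [roundMean_loss_sub_lossEst P (play_mem_simplex _ _ _) (play_mem_simplex _ _ _) k
      (weights_pos n.succ_pos _ k) (weights_pos n.succ_pos _ k), roundMean_mul]

theorem expect_regret_le {K : ℕ} [NeZero K] (P : PreferenceMatrix K) (c k : Fin K) (T : ℕ) :
    expect P T (regret P k) ≤ 1 / 2 * (expect P T (playSum .plus (roundBound c))
      + expect P T (playSum .minus (roundBound c))) := by
  have h : ∀ i : Player, expect P T (fun h => ∑ t, loss i (h t) - cumEst i T h k)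
      ≤ expect P T (playSum i (roundBound c)) := fun i => by
    have h1 := expect_mono P T fun h => le_potential i h k
    rw [expect_add, expect_const] at h1
    have h2 := expect_potential_le P i c T
    linarith
  rw [expect_regret_eq_estimated, expect_add]
  have h1 := h .plus
  have h2 := h .minus
  linarith

/-! ### The logarithmic bound -/

theorem expect_two_mul_roundBound_sub_le {K : ℕ} [NeZero K] (P : PreferenceMatrix K) (c : Fin K)
    {D : Fin K → ℝ} (hD0 : ∀ k, k ≠ c → 0 < D k) (hD1 : ∀ k, D k ≤ 1 / 2) (i : Player) (T : ℕ) :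
    2 * expect P T (playSum i (roundBound c))
        - expect P T (playSum i fun _ w => ∑ k with k ≠ c, w k * D k)
      ≤ ∑ k with k ≠ c, (4 * Real.log T + 12) / D k + (4 * Real.log T + 4) := by
  rw [sub_eq_add_neg, ← neg_one_mul, ← expect_mul, ← expect_mul, ← expect_add]
  refine (expect_mono P T fun h => ?_).trans_eq (expect_const P T _)
  have h1 := sum_roundBound_le c hD0 hD1
    (w := fun t : Fin T => play i t (Fin.take t t.is_lt.le h)) (fun t => play_mem_simplex _ _ _)
    fun t k => weights_pos (Nat.succ_pos _) _ k
  rw [Finset.sum_sub_distrib, ← Finset.mul_sum] at h1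
  simp only [playSum]
  linarith

end DuelingBandit

theorem mainTheorem2 (K : ℕ) [NeZero K] (P : PreferenceMatrix K) (cw : Fin K)
    (hcw : IsCondorcetWinner P cw) (T : ℕ) (hT : 1 ≤ T) :
    expect P T (regret P cw) = weightedGapSum P T (gap P cw) cw ∧
    SelfBounding P T (gap P cw) cw 0 ∧
    pseudoRegret P T ≤
      (∑ k with k ≠ cw, (4 * Real.log T + 12) / gap P cw k) + 4 * Real.log T
        + 1 / gapMin P cw + 3 / 2 * √(K : ℝ) + 8 := by
  have heq := expect_regret_eq P cw T
  have hgap0 : ∀ k, k ≠ cw → 0 < gap P cw k := fun k hk => sub_pos.2 (hcw k hk)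
  have hgapc : gap P cw cw = 0 := by rw [gap, prob_self, sub_self]
  have hgap1 : ∀ k, gap P cw k ≤ 1 / 2 := fun k => by
    have h1 := P.add_swap cw k
    have h2 := P.nonneg k cw
    rw [gap]
    linarith
  have hgapn : ∀ k, 0 ≤ gap P cw k := fun k => by
    by_cases hk : k = cw
    · rw [hk, hgapc]
    · exact (hgap0 k hk).le
  have hlow : weightedGapSum P T (gap P cw) cw ≤ pseudoRegret P T :=
    heq ▸ Finset.le_sup' (fun k => expect P T (regret P k)) (Finset.mem_univ cw)
  refine ⟨heq, ⟨fun k => ⟨hgapn k, (hgap1 k).trans (by norm_num)⟩,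
    fun k => ⟨fun h => ?_, fun h => ?_⟩, le_rfl, by rwa [sub_zero]⟩, ?_⟩
  · by_contra hk
    exact (hgap0 k hk).ne' h
  · rw [h, hgapc]
  · have hup : pseudoRegret P T ≤ 1 / 2 * (expect P T (playSum .plus (roundBound cw))
        + expect P T (playSum .minus (roundBound cw))) :=
      Finset.sup'_le _ _ fun k _ => expect_regret_le P cw k T
    have h1 := expect_two_mul_roundBound_sub_le P cw hgap0 hgap1 .plus T
    have h2 := expect_two_mul_roundBound_sub_le P cw hgap0 hgap1 .minus T
    -- Also for a single arm, where the infimum is empty and `1 / gapMin` is zero.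
    have hmin : 0 ≤ 1 / gapMin P cw := one_div_nonneg.2 (Real.iInf_nonneg fun k => hgapn k)
    have hK : 0 ≤ 3 / 2 * √(K : ℝ) := by positivity
    rw [weightedGapSum_eq] at hlow
    -- Subtract the self-bounding lower bound from twice the upper bound.
    linarith
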